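/- **Setting.** Let $M$ be a finite-dimensional, connected, paracompact, Hausdorff $C^\infty$ manifold with tangent bundle $\pi:TM\to M$. A *spray* on $M$ is a $C^\infty$ vector field $S$ on the whole of $TM$ with $T\pi\circ S=\mathrm{id}_{TM}$; in local coordinates, $S(x,y)=(x,y,y,Y(x,y))$. Let $C$ be the Euler vector field on $TM$, $C(x,y)=(x,y,0,y)$. For a real number $m\ge 0$, the spray $S$ is *homogeneous of degree $m$* if $[C,S]=(m-1)S$. Let $\mathrm{Spr}_m(M)$ be the set of the sprays that are homogeneous of degree $m$, and let $\mathrm{Spr}_H(M)=\bigcup_{m\ge 0}\mathrm{Spr}_m(M)$. A *geodesic* of $S$ is a curve $c:(a,b)\to M$, $-\infty\le a<b\le\infty$, whose canonical lift $\dot c$ to $TM$ is an integral curve of $S$; it is *inextendible* if it is not the restriction of a geodesic defined on a larger open interval. A *geodesic segment* is the restriction of a geodesic to a compact subinterval of its domain. The spray $S$ is *pseudoconvex* if for each compact $K\subseteq M$ there is a compact $K'\subseteq M$ such that each geodesic segment of $S$ with both endpoints in $K$ lies in $K'$. It is *disprisoning* if no inextendible nonconstant geodesic of $S$ is contained in a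 compact subset of $M$. Let $h$ be a complete Riemannian metric on $M$ and let $UM\subseteq TM$ be its unit sphere bundle. Give $\mathrm{Spr}_m(M)$ the $C^0$-fine (Whitney) topology of the restrictions to $UM$: the sets $\{S\in\mathrm{Spr}_m(M): S(UM)\subseteq W\}$, with $W$ open in $TTM$, form a basis. Give $\mathrm{Spr}_H(M)$ the weak topology generated by these: a subset is open if and only if its intersection with $\mathrm{Spr}_m(M)$ is open in $\mathrm{Spr}_m(M)$ for every $m\ge 0$. **Theorem.** If $S\in \mathrm{Spr}_H(M)$ is pseudoconvex and disprisoning, then there is an open neighbourhood $W(S)$ of $S$ in $\mathrm{Spr}_H(M)$ such that every $S'\in W(S)$ (of whatever degree of homogeneity) is both pseudoconvex and disprisoning. -/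

import Mathlib

open Set Filter Topology Manifold Bundle
open scoped ContDiff NNReal ENNReal

noncomputable section

namespace SprayStability

variable (E : Type*) [NormedAddCommGroup E] [NormedSpace ℝ E]
  (M : Type*) [TopologicalSpace M] [ChartedSpace E M] [IsManifold 𝓘(ℝ, E) ∞ M]

/-- The tangent bundle `TM`. -/
abbrev TM : Type _ := TangentBundle 𝓘(ℝ, E) M

/-- The tangent bundle `TTM` of the manifold `TM`. -/
abbrev TTM : Type _ := TangentBundle 𝓘(ℝ, E).tangent (TM E M)

/-- A (general) spray on `M`: a smooth section `S` of `TTM → TM`, defined on all of `TM`, which is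
projectable, i.e. `Tπ ∘ S = id` where `π : TM → M` is the projection.  In local coordinates the
condition says that `S (x, y) = (x, y, y, Y (x, y))`, that is, `S` is fixed by the canonical
involution of `TTM`. -/
structure Spray where
  /-- The underlying vector field on `TM`. -/
  toFun : ∀ v : TM E M, TangentSpace 𝓘(ℝ, E).tangent v
  smooth : ContMDiff 𝓘(ℝ, E).tangent 𝓘(ℝ, E).tangent.tangent ∞
    (fun v : TM E M => (⟨v, toFun v⟩ : TTM E M))
  projectable : ∀ v : TM E M,
    mfderiv 𝓘(ℝ, E).tangent 𝓘(ℝ, E) (fun w : TM E M => w.proj) v (toFun v) = v.snd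

/-- The Euler (Liouville) vector field `C` on `TM`, `(x, y) ↦ (x, y, 0, y)` in coordinates: its
value at `v` is the velocity at `t = 1` of the curve `t ↦ t v` in the fibre through `v`. -/
def euler (v : TM E M) : TangentSpace 𝓘(ℝ, E).tangent v :=
  mfderiv 𝓘(ℝ, ℝ) 𝓘(ℝ, E).tangent (fun t : ℝ => (⟨v.proj, t • v.snd⟩ : TM E M)) 1 (1 : ℝ)

variable {E M}

/-- The spray `S` is (positively) homogeneous of degree `m`: `[C, S] = (m - 1) S`. -/
def Spray.IsHomogeneous (S : Spray E M) (m : ℝ≥0) : Prop :=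
  ∀ v : TM E M, VectorField.mlieBracket 𝓘(ℝ, E).tangent (euler E M) S.toFun v =
    ((m : ℝ) - 1) • S.toFun v

/-- The canonical lift to `TM` of a curve `c` in `M`. -/
def lift (c : ℝ → M) (t : ℝ) : TM E M :=
  ⟨c t, mfderiv 𝓘(ℝ, ℝ) 𝓘(ℝ, E) c t (1 : ℝ)⟩

/-- A nonempty, possibly unbounded, open interval `(a, b)` of the real line. -/
def IsOpenInterval (J : Set ℝ) : Prop := IsOpen J ∧ J.OrdConnected ∧ J.Nonempty

/-- `c` (of which only the restriction to `J` matters) is a geodesic of `S` with domain the open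
interval `J`: its canonical lift is an integral curve of `S`. -/
def Spray.IsGeodesicOn (S : Spray E M) (c : ℝ → M) (J : Set ℝ) : Prop :=
  IsOpenInterval J ∧ IsMIntegralCurveOn (I := 𝓘(ℝ, E).tangent) (lift (E := E) c) S.toFun J

/-- An inextendible geodesic: one that does not extend to a geodesic on a larger open interval. -/
def Spray.IsInextendible (S : Spray E M) (c : ℝ → M) (J : Set ℝ) : Prop :=
  S.IsGeodesicOn c J ∧
    ∀ (c' : ℝ → M) (J' : Set ℝ), S.IsGeodesicOn c' J' → J ⊆ J' → EqOn c' c J → J' = J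

/-- `S` is pseudoconvex: for each compact `K` there is a compact `K'` such that each geodesic
segment (the restriction of a geodesic to a compact interval `[a, b]` of its domain) with both
endpoints in `K` lies in `K'`. -/
def Spray.IsPseudoconvex (S : Spray E M) : Prop :=
  ∀ K : Set M, IsCompact K → ∃ K' : Set M, IsCompact K' ∧
    ∀ (c : ℝ → M) (J : Set ℝ), S.IsGeodesicOn c J →
      ∀ a ∈ J, ∀ b ∈ J, a ≤ b → c a ∈ K → c b ∈ K → ∀ t ∈ Icc a b, c t ∈ K'

/-- `S` is disprisoning: no inextendible nonconstant geodesic lies in a compact set. -/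
def Spray.IsDisprisoning (S : Spray E M) : Prop :=
  ∀ (c : ℝ → M) (J : Set ℝ), S.IsInextendible c J → (¬ ∃ p : M, ∀ t ∈ J, c t = p) →
    ∀ K : Set M, IsCompact K → ¬ c '' J ⊆ K

variable (E M)

/-- Smooth Riemannian metrics on `M`. -/
abbrev RMetric : Type _ :=
  ContMDiffRiemannianMetric 𝓘(ℝ, E) ∞ E (fun x : M => TangentSpace 𝓘(ℝ, E) x)

variable {E M}

/-- The Riemannian distance of `h`: the infimum of the `h`-lengths of `C¹` paths. -/
def rdist (h : RMetric E M) (x y : M) : ℝ≥0∞ :=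
  letI : RiemannianBundle (fun x : M => TangentSpace 𝓘(ℝ, E) x) := ⟨h.toRiemannianMetric⟩
  riemannianEDist 𝓘(ℝ, E) x y

/-- The metric `h` is complete: each sequence that is Cauchy for its distance converges. -/
def IsCompleteMetric (h : RMetric E M) : Prop :=
  ∀ u : ℕ → M, (∀ ε : ℝ≥0∞, 0 < ε → ∃ N : ℕ, ∀ i ≥ N, ∀ j ≥ N, rdist h (u i) (u j) < ε) →
    ∃ x : M, Tendsto u atTop (𝓝 x)

/-- The `h`-unit sphere bundle `UM ⊆ TM`. -/
def unitBundle (h : RMetric E M) : Set (TM E M) :=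
  {v | h.inner v.proj v.snd v.snd = 1}

variable (E M)

/-- The set `Spr_m(M)` of the sprays on `M` that are homogeneous of degree `m`. -/
def Spr (m : ℝ≥0) : Type _ := {S : Spray E M // S.IsHomogeneous m}

/-- The set `Spr_H(M)` of the sprays on `M` that are homogeneous of some degree. -/
def SprH : Type _ := {S : Spray E M // ∃ m : ℝ≥0, S.IsHomogeneous m}

variable {E M}

/-- The inclusion of `Spr_m(M)` in `Spr_H(M)`. -/
def Spr.incl (m : ℝ≥0) (S : Spr E M m) : SprH E M := ⟨S.1, m, S.2⟩

/-- The `C⁰`-fine (Whitney) topology on `Spr_m(M)`, for restrictions to the unit sphere bundle `UM`: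
a basis is given, as `W` runs through the open subsets of `TTM`, by the sets of those `S` whose
restriction to `UM` has its image in `W`. -/
abbrev fineTopology (h : RMetric E M) (m : ℝ≥0) : TopologicalSpace (Spr E M m) :=
  TopologicalSpace.generateFrom
    {U | ∃ W : Set (TTM E M), IsOpen W ∧
      U = {S | ∀ v ∈ unitBundle h, (⟨v, S.1.toFun v⟩ : TTM E M) ∈ W}}

/-- The weak topology on `Spr_H(M)` generated by the topologies of the subsets `Spr_m(M)`: a set is
open if and only if its intersection with each `Spr_m(M)` is open in `Spr_m(M)`. -/
abbrev weakTopology (h : RMetric E M) : TopologicalSpace (SprH E M) :=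
  ⨆ m : ℝ≥0, (fineTopology h m).coinduced (Spr.incl m)

end SprayStability

end

noncomputable section

namespace SprayStability

/-! ### Velocities of curves in manifolds -/

/-! Projectability and smoothness along the zero section make every homogeneous spray quadratic on
the fibres (`Spray.val_smulTM`): unless the model space is trivial, the degree is `2`. Hence
geodesics can be reversed, a geodesic with one zero velocity is constant, and the values of a spray
on `UM` determine it.

Parametrized by `h`-arc length, a nonconstant geodesic becomes an integral curve of the field
`Spray.unitField`, which is `S` minus the multiple of the Euler field that keeps the length equal to
`1`. The unit bundle over a compact set is compact. So unit speed geodesics over a compact set, of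
sprays converging to `S` there, have pointwise limits along an ultrafilter, and these limits are
unit speed geodesics of `S` (`exists_limit_unitCurve`). The tool is `limit_estimate`: in a chart,
curves with nearly constant velocity are nearly straight for a time independent of the curve.

Two facts connect unit speed with affine parameters. An inextendible geodesic trapped in a compact
set has infinite length (`exists_lt_length_of_inextendible`), and a unit curve on all of `ℝ` gives
an inextendible geodesic (`Spray.IsUnitCurve.exists_inextendible`). Thus a disprisoning spray has no
unit speed ray in a compact set: translating such a ray to infinity and taking a limit would give a
complete trapped geodesic.

Over a compact set `A`, both properties then persist near `S`, by contradiction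
(`exists_isOpen_stable`). Trapped rays converge to a trapped ray of `S`. Segments in `A` with ends
in `B` that pass outside `B₁` cannot have unbounded length on either side of the outside point, so
they converge to a segment of `S` with ends in a slightly larger `B'` and a point outside the
interior of `B₁`; the choice of `B₁` from pseudoconvexity forbids this.

To globalize, take an exhaustion `B n` in which `B (n + 1)` absorbs the hull of a neighbourhood of
`B n`, and impose stability over each shell `B (n + 2) \ interior (B n)`. The shells are locally
finite, so these conditions amount to one open subset of `TTM`. Descending through the shells, a
geodesic segment with ends in `B n` is confined to `B (n + 1)` (`mem_succ_of_stable`). A trapped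
geodesic would either have a ray in one shell or violate this confinement
(`isDisprisoning_of_stable`). -/

lemma hasDerivAt_of_hasFDerivAt_comp_smulRight {F G : Type*} [NormedAddCommGroup F]
    [NormedSpace ℝ F] [NormedAddCommGroup G] [NormedSpace ℝ G] {A : F →L[ℝ] G} {w : F}
    {f : ℝ → G} {t : ℝ} (h : HasFDerivAt f (A ∘L ((1 : ℝ →L[ℝ] ℝ).smulRight w)) t) :
    HasDerivAt f (A w) t := by
  simpa using h.hasDerivAt

section Velocity

variable {F H N : Type*} [NormedAddCommGroup F] [NormedSpace ℝ F] [TopologicalSpace H]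
  {I : ModelWithCorners ℝ F H} [TopologicalSpace N] [ChartedSpace H N]
  {γ γ' : ℝ → N} {w : F} {t : ℝ}

variable (I) in
/-- The curve `γ` has velocity `w` at time `t`, where `w` is read in the preferred chart
at `γ t`. -/
def HasVelocityAt (γ : ℝ → N) (w : F) (t : ℝ) : Prop :=
  ContinuousAt γ t ∧ HasDerivAt (fun s => extChartAt I (γ t) (γ s)) w t

lemma hasMFDerivAt_iff_hasVelocityAt {L : ℝ →L[ℝ] F} :
    HasMFDerivAt 𝓘(ℝ, ℝ) I γ t L ↔ HasVelocityAt I γ (L 1) t := by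
  unfold HasMFDerivAt HasVelocityAt
  refine and_congr_right fun _ => ?_
  rw [hasDerivAt_iff_hasFDerivAt]
  have : ContinuousLinearMap.toSpanSingleton ℝ (L 1) = L := by
    ext; simp
  rw [this]
  simp only [writtenInExtChartAt, extChartAt_model_space_eq_id, modelWithCornersSelf_coe,
    range_id, PartialEquiv.refl_coe, PartialEquiv.refl_symm, Function.comp_def, id]
  exact hasFDerivWithinAt_univ

lemma hasVelocityAt_iff_hasMFDerivAt :
    HasVelocityAt I γ w t ↔
      HasMFDerivAt 𝓘(ℝ, ℝ) I γ t ((1 : ℝ →L[ℝ] ℝ).smulRight w : ℝ →L[ℝ] F) := by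
  rw [hasMFDerivAt_iff_hasVelocityAt]
  simp

lemma HasVelocityAt.continuousAt (h : HasVelocityAt I γ w t) : ContinuousAt γ t := h.1

lemma HasVelocityAt.congr (h : HasVelocityAt I γ w t) (h' : γ' =ᶠ[𝓝 t] γ) :
    HasVelocityAt I γ' w t := by
  refine ⟨h.1.congr h'.symm, ?_⟩
  rw [h'.eq_of_nhds]
  exact h.2.congr_of_eventuallyEq (h'.fun_comp _)

lemma HasVelocityAt.unique {w' : F} (h : HasVelocityAt I γ w t) (h' : HasVelocityAt I γ w' t) :
    w = w' := h.2.unique h'.2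

lemma HasVelocityAt.comp {σ : ℝ → ℝ} {σ' s : ℝ} (h : HasVelocityAt I γ w (σ s))
    (hσ : HasDerivAt σ σ' s) : HasVelocityAt I (fun r => γ (σ r)) (σ' • w) s :=
  ⟨ContinuousAt.comp (f := σ) h.1 hσ.continuousAt,
    HasDerivAt.scomp (h := σ) s h.2 hσ⟩

lemma HasVelocityAt.hasDerivAt_comp {f : N → ℝ} (h : HasVelocityAt I γ w t)
    (hf : MDifferentiableAt I 𝓘(ℝ, ℝ) f (γ t)) :
    HasDerivAt (fun s => f (γ s)) ((mfderiv I 𝓘(ℝ, ℝ) f (γ t) : F →L[ℝ] ℝ) w) t := by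
  exact hasDerivAt_of_hasFDerivAt_comp_smulRight (F := F) (hasMFDerivAt_iff_hasFDerivAt.1
    (hf.hasMFDerivAt.comp t (hasVelocityAt_iff_hasMFDerivAt.1 h)))

variable [IsManifold I 1 N]

/-- Velocities are read in the chart at the moving point, whereas limits and estimates need a fixed
chart at `p`; the trivialization is the derivative of that change of chart. -/
lemma HasVelocityAt.hasDerivAt_extChartAt (h : HasVelocityAt I γ w t) {p : N}
    (hp : γ t ∈ (chartAt H p).source) :
    HasDerivAt (fun s => extChartAt I p (γ s))
      (trivializationAt F (TangentSpace I) p ⟨γ t, w⟩).2 t := by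
  have h3 : HasDerivAt (fun s => extChartAt I p (γ s))
      ((mfderiv I 𝓘(ℝ, F) (extChartAt I p) (γ t) : F →L[ℝ] F) w) t :=
    hasDerivAt_of_hasFDerivAt_comp_smulRight (F := F) (hasMFDerivAt_iff_hasFDerivAt.1
      ((mdifferentiableAt_extChartAt (I := I) hp).hasMFDerivAt.comp t
        (hasVelocityAt_iff_hasMFDerivAt.1 h)))
  have h4 := (trivializationAt F (TangentSpace I) p).continuousLinearMapAt_apply_of_mem (R := ℝ)
    (b := γ t) hp
  rw [TangentBundle.continuousLinearMapAt_trivializationAt hp] at h4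
  have h5 : (trivializationAt F (TangentSpace I) p ⟨γ t, w⟩).2 =
      (mfderiv I 𝓘(ℝ, F) (extChartAt I p) (γ t) : F →L[ℝ] F) w := (h4 w).symm
  rw [h5]
  exact h3

end Velocity

/-! ### Curves in the tangent bundle -/

section TangentBundleCurves

variable {E : Type*} [NormedAddCommGroup E] [NormedSpace ℝ E]
  {M : Type*} [TopologicalSpace M] [ChartedSpace E M]

/-- The fibre component of a tangent vector, as an element of the model space. -/
noncomputable def fib (v : TM E M) : E := v.snd

/-- The tangent vector with given base point and fibre component. -/
noncomputable def mkTM (x : M) (y : E) : TM E M := ⟨x, y⟩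

/-- Multiplication of a tangent vector by a scalar. -/
noncomputable def smulTM (c : ℝ) (v : TM E M) : TM E M := mkTM v.proj (c • fib v)

@[simp] lemma mkTM_proj (x : M) (y : E) : (mkTM x y : TM E M).proj = x := rfl
@[simp] lemma fib_mkTM (x : M) (y : E) : fib (mkTM x y : TM E M) = y := rfl
@[simp] lemma mkTM_fib (v : TM E M) : mkTM v.proj (fib v) = v := rfl
@[simp] lemma smulTM_proj (c : ℝ) (v : TM E M) : (smulTM c v).proj = v.proj := rfl
@[simp] lemma fib_smulTM (c : ℝ) (v : TM E M) : fib (smulTM c v) = c • fib v := rfl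
@[simp] lemma smulTM_one (v : TM E M) : smulTM 1 v = v := by simp [smulTM]
lemma smulTM_smulTM (a b : ℝ) (v : TM E M) : smulTM a (smulTM b v) = smulTM (a * b) v := by
  simp [smulTM, smul_smul]

variable [IsManifold 𝓘(ℝ, E) ∞ M]

/-- The tangent vector of `TM` at `v` with given fibre component. -/
def mkTTM (v : TM E M) (w : E × E) : TTM E M := ⟨v, w⟩

/-- The value of a spray, as an element of the model space. -/
def Spray.val (S : Spray E M) (v : TM E M) : E × E := S.toFun v

lemma extChartAt_tangent_apply (v w : TM E M) :
    extChartAt 𝓘(ℝ, E).tangent v w =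
      (extChartAt 𝓘(ℝ, E) v.proj w.proj,
        (trivializationAt E (TangentSpace 𝓘(ℝ, E)) v.proj w).2) := by
  rw [FiberBundle.extChartAt]
  rfl

lemma trivializationAt_self (v : TM E M) :
    (trivializationAt E (TangentSpace 𝓘(ℝ, E)) v.proj v).2 = fib v := by
  have h := TangentBundle.continuousLinearMapAt_trivializationAt (I := 𝓘(ℝ, E))
    (mem_chart_source E v.proj)
  have h4 := (trivializationAt E (TangentSpace 𝓘(ℝ, E)) v.proj).continuousLinearMapAt_apply_of_mem
    (R := ℝ) (b := v.proj) (mem_chart_source E v.proj) v.snd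
  rw [h, mfderiv_extChartAt_self] at h4
  exact h4.symm

lemma trivializationAt_smul (x : M) (v : TM E M) (hv : v.proj ∈ (chartAt E x).source) (c : ℝ) :
    (trivializationAt E (TangentSpace 𝓘(ℝ, E)) x (smulTM c v)).2 =
      c • (trivializationAt E (TangentSpace 𝓘(ℝ, E)) x v).2 :=
  ((trivializationAt E (TangentSpace 𝓘(ℝ, E)) x).linear ℝ hv).map_smul c v.snd


/-- The product and chain rules in `TM`. Time reversal, the passage to arc length and the passage
back to an affine parameter are all instances of it. -/
lemma hasVelocityAt_smul {γ : ℝ → TM E M} {w : E × E} {σ l : ℝ → ℝ} {σ' l' s : ℝ}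
    (h : HasVelocityAt 𝓘(ℝ, E).tangent γ w (σ s)) (hσ : HasDerivAt σ σ' s)
    (hl : HasDerivAt l l' s) :
    HasVelocityAt 𝓘(ℝ, E).tangent (fun r => smulTM (l r) (γ (σ r)))
      (σ' • w.1, (l s * σ') • w.2 + l' • fib (γ (σ s))) s := by
  have hγ := h.comp hσ
  set g : ℝ → TM E M := fun r => γ (σ r) with hg
  have hp : ContinuousAt (fun r => (g r).proj) s :=
    (FiberBundle.continuous_proj E (TangentSpace 𝓘(ℝ, E))).continuousAt.comp hγ.1
  have hsrc : ∀ᶠ r in 𝓝 s, (g r).proj ∈ (chartAt E (g s).proj).source :=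
    hp.eventually_mem ((chartAt E (g s).proj).open_source.mem_nhds (mem_chart_source _ _))
  have hd : HasDerivAt (fun r => (extChartAt 𝓘(ℝ, E) (g s).proj (g r).proj,
      (trivializationAt E (TangentSpace 𝓘(ℝ, E)) (g s).proj (g r)).2)) (σ' • w) s := by
    simpa only [← extChartAt_tangent_apply] using hγ.2
  have hd1 := hd.fst
  have hd2 := hd.snd
  have hd3 := hl.smul hd2
  have he : (fun r => (trivializationAt E (TangentSpace 𝓘(ℝ, E)) (g s).proj
      (smulTM (l r) (g r))).2) =ᶠ[𝓝 s] fun r => l r •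
        (trivializationAt E (TangentSpace 𝓘(ℝ, E)) (g s).proj (g r)).2 := by
    filter_upwards [hsrc] with r hr using trivializationAt_smul _ _ hr _
  have hd4 := hd3.congr_of_eventuallyEq he
  refine ⟨?_, ?_⟩
  · rw [FiberBundle.continuousAt_totalSpace]
    exact ⟨hp, hd4.continuousAt⟩
  · simp only [extChartAt_tangent_apply]
    have hd5 := hd1.prodMk hd4
    simp only [Prod.smul_snd, trivializationAt_self, smul_smul] at hd5
    exact hd5

lemma HasVelocityAt.proj {γ : ℝ → TM E M} {w : E × E} {t : ℝ}
    (h : HasVelocityAt 𝓘(ℝ, E).tangent γ w t) :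
    HasVelocityAt 𝓘(ℝ, E) (fun s => (γ s).proj) w.1 t := by
  refine ⟨(FiberBundle.continuous_proj E (TangentSpace 𝓘(ℝ, E))).continuousAt.comp h.1, ?_⟩
  have := h.2
  simp only [extChartAt_tangent_apply] at this
  exact this.fst

lemma hasVelocityAt_const {F H N : Type*} [NormedAddCommGroup F] [NormedSpace ℝ F]
    [TopologicalSpace H] {I : ModelWithCorners ℝ F H} [TopologicalSpace N] [ChartedSpace H N]
    (p : N) (t : ℝ) : HasVelocityAt I (fun _ => p) (0 : F) t :=
  ⟨continuousAt_const, hasDerivAt_const _ _⟩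

lemma hasVelocityAt_ray (v : TM E M) (t : ℝ) :
    HasVelocityAt 𝓘(ℝ, E).tangent (fun r => smulTM r v) ((0 : E), fib v) t := by
  have := hasVelocityAt_smul (hasVelocityAt_const (I := 𝓘(ℝ, E).tangent) v t) (hasDerivAt_id t)
    (hasDerivAt_id t)
  simpa using this

lemma euler_eq (v : TM E M) : (euler E M v : E × E) = ((0 : E), fib v) := by
  have h := (hasVelocityAt_iff_hasMFDerivAt.1 (hasVelocityAt_ray v 1)).mfderiv
  unfold euler
  have h2 : (mfderiv 𝓘(ℝ, ℝ) 𝓘(ℝ, E).tangent (fun t : ℝ => (⟨v.proj, t • v.snd⟩ : TM E M)) 1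
      : ℝ →L[ℝ] E × E) (1 : ℝ) =
      ((1 : ℝ →L[ℝ] ℝ).smulRight ((0 : E), fib v) : ℝ →L[ℝ] E × E) 1 :=
    congrArg (fun L : ℝ →L[ℝ] E × E => L 1) h
  exact h2.trans (one_smul ℝ ((0 : E), fib v))

/-- Both sides are the derivative at `1` of the ray `r ↦ r q` read in the chart at `p`, where the
ray is still linear. -/
lemma trivializationAt_vertical (p q : TM E M) (hq : q.proj ∈ (chartAt E p.proj).source) :
    (trivializationAt (E × E) (TangentSpace 𝓘(ℝ, E).tangent) p
      (mkTTM q ((0 : E), fib q))).2 =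
    ((0 : E), (trivializationAt E (TangentSpace 𝓘(ℝ, E)) p.proj q).2) := by
  have hr := hasVelocityAt_ray q 1
  have hq' : smulTM 1 q ∈ (chartAt (ModelProd E E) p).source := by
    simpa [smulTM] using hq
  have h1 := hr.hasDerivAt_extChartAt hq'
  have h2 : HasDerivAt (fun r : ℝ => (extChartAt 𝓘(ℝ, E) p.proj q.proj,
      r • (trivializationAt E (TangentSpace 𝓘(ℝ, E)) p.proj q).2))
      ((0 : E), (1 : ℝ) • (trivializationAt E (TangentSpace 𝓘(ℝ, E)) p.proj q).2) 1 :=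
    (hasDerivAt_const _ _).prodMk ((hasDerivAt_id (1 : ℝ)).smul_const _)
  have h3 : (fun r : ℝ => (extChartAt 𝓘(ℝ, E) p.proj q.proj,
      r • (trivializationAt E (TangentSpace 𝓘(ℝ, E)) p.proj q).2)) =
      fun r => extChartAt 𝓘(ℝ, E).tangent p (smulTM r q) := by
    ext1 r
    rw [extChartAt_tangent_apply, ← trivializationAt_smul _ _ hq]
    rfl
  rw [h3] at h2
  have h4 := h1.unique h2
  rw [one_smul] at h4
  rw [smulTM_one] at h4
  exact h4

lemma mfderiv_proj_apply (v : TM E M) (w : E × E) :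
    (mfderiv 𝓘(ℝ, E).tangent 𝓘(ℝ, E) (fun w : TM E M => w.proj) v : E × E →L[ℝ] E) w = w.1 := by
  have h : HasMFDerivAt 𝓘(ℝ, E).tangent 𝓘(ℝ, E) (fun w : TM E M => w.proj) v
      (ContinuousLinearMap.fst ℝ E E) := by
    refine ⟨(FiberBundle.continuous_proj E (TangentSpace 𝓘(ℝ, E))).continuousAt, ?_⟩
    have h1 := (ContinuousLinearMap.fst ℝ E E).hasFDerivAt.hasFDerivWithinAt
      (s := range 𝓘(ℝ, E).tangent) (x := extChartAt 𝓘(ℝ, E).tangent v v)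
    refine h1.congr_of_eventuallyEq ?_ ?_
    · filter_upwards [extChartAt_target_mem_nhdsWithin (I := 𝓘(ℝ, E).tangent) v] with z hz
      have h2 : extChartAt 𝓘(ℝ, E).tangent v ((extChartAt 𝓘(ℝ, E).tangent v).symm z) = z :=
        (extChartAt 𝓘(ℝ, E).tangent v).right_inv hz
      rw [extChartAt_tangent_apply] at h2
      exact congrArg Prod.fst h2
    · have h2 : (extChartAt 𝓘(ℝ, E).tangent v).symm (extChartAt 𝓘(ℝ, E).tangent v v) = v :=
        (extChartAt 𝓘(ℝ, E).tangent v).left_inv (mem_extChartAt_source v)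
      change extChartAt 𝓘(ℝ, E) v.proj ((extChartAt 𝓘(ℝ, E).tangent v).symm
        (extChartAt 𝓘(ℝ, E).tangent v v)).proj = _
      rw [h2, extChartAt_tangent_apply]
      rfl
  exact congrArg (fun L : E × E →L[ℝ] E => L w) h.mfderiv

lemma Spray.fst_eq (S : Spray E M) (v : TM E M) : (S.val v).1 = fib v :=
  (mfderiv_proj_apply v (S.val v)).symm.trans (S.projectable v)

end TangentBundleCurves

/-! ### Homogeneity of sprays -/

section Homogeneity

variable {E : Type*} [NormedAddCommGroup E] [NormedSpace ℝ E]
  {M : Type*} [TopologicalSpace M] [ChartedSpace E M] [IsManifold 𝓘(ℝ, E) ∞ M]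

/-- The preferred chart of `TM` at a vector depends only on its base point. So along a fibre the
values of a spray can be compared as elements of `E × E`. -/
lemma trivializationAt_congr {p q : TM E M} (h : p.proj = q.proj) :
    trivializationAt (E × E) (TangentSpace 𝓘(ℝ, E).tangent) p =
      trivializationAt (E × E) (TangentSpace 𝓘(ℝ, E).tangent) q := by
  have h1 : achart (ModelProd E E) p = achart (ModelProd E E) q := by
    apply Subtype.ext
    change chartAt (ModelProd E E) p = chartAt (ModelProd E E) q
    rw [TangentBundle.chartAt, TangentBundle.chartAt, h]
  rw [TangentBundle.trivializationAt_eq_localTriv, TangentBundle.trivializationAt_eq_localTriv, h1]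

lemma trivializationAt_mkTTM {p q : TM E M} (h : p.proj = q.proj) (w : E × E) :
    (trivializationAt (E × E) (TangentSpace 𝓘(ℝ, E).tangent) p (mkTTM q w)).2 = w := by
  rw [trivializationAt_congr h]
  have h1 := TangentBundle.continuousLinearMapAt_trivializationAt (I := 𝓘(ℝ, E).tangent)
    (mem_chart_source (ModelProd E E) q)
  have h4 := (trivializationAt (E × E) (TangentSpace 𝓘(ℝ, E).tangent)
    q).continuousLinearMapAt_apply_of_mem
    (R := ℝ) (b := q) (mem_chart_source (ModelProd E E) q) w
  rw [h1, mfderiv_extChartAt_self] at h4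
  exact h4.symm

lemma Spray.contMDiff (S : Spray E M) :
    ContMDiff 𝓘(ℝ, E).tangent 𝓘(ℝ, E).tangent.tangent ∞ (fun v => mkTTM v (S.val v)) := S.smooth

lemma Spray.contMDiffAt_trivializationAt (S : Spray E M) (p : TM E M) :
    ContMDiffAt 𝓘(ℝ, E).tangent 𝓘(ℝ, E × E) ∞ (fun v =>
      (trivializationAt (E × E) (TangentSpace 𝓘(ℝ, E).tangent) p (mkTTM v (S.val v))).2) p :=
  (contMDiffAt_totalSpace.1 (S.contMDiff p)).2

lemma contMDiff_ray (v : TM E M) :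
    ContMDiff 𝓘(ℝ, ℝ) 𝓘(ℝ, E).tangent ∞ (fun r : ℝ => smulTM r v) := by
  intro r
  refine contMDiffAt_totalSpace.2 ⟨contMDiffAt_const, ?_⟩
  have h : (fun r : ℝ => (trivializationAt E (TangentSpace 𝓘(ℝ, E)) v.proj (smulTM r v)).2) =
      fun r => r • fib v := by
    ext1 r
    rw [trivializationAt_smul _ _ (mem_chart_source _ _), trivializationAt_self]
  have h2 : ContMDiffAt 𝓘(ℝ, ℝ) 𝓘(ℝ, E) ∞
      (fun r : ℝ => (trivializationAt E (TangentSpace 𝓘(ℝ, E)) v.proj (smulTM r v)).2) r := by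
    rw [h]
    exact (contDiff_id.smul contDiff_const).contMDiff r
  exact h2

lemma Spray.contDiff_ray (S : Spray E M) (v : TM E M) :
    ContDiff ℝ ∞ (fun r : ℝ => S.val (smulTM r v)) := by
  rw [← contMDiff_iff_contDiff]
  intro r
  have h := (S.contMDiffAt_trivializationAt (smulTM r v)).comp r (contMDiff_ray v r)
  refine h.congr_of_eventuallyEq (Eventually.of_forall fun s => ?_)
  exact (trivializationAt_mkTTM rfl _).symm

lemma mpullbackWithin_extChartAt_symm (p : TM E M) (V : TM E M → E × E) {z : E × E}
    (hz : z ∈ (extChartAt 𝓘(ℝ, E).tangent p).target) :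
    (VectorField.mpullbackWithin 𝓘(ℝ, E × E) 𝓘(ℝ, E).tangent (extChartAt 𝓘(ℝ, E).tangent p).symm
      (fun v => V v) (range 𝓘(ℝ, E).tangent) z : E × E) =
    (trivializationAt (E × E) (TangentSpace 𝓘(ℝ, E).tangent) p
      (mkTTM ((extChartAt 𝓘(ℝ, E).tangent p).symm z)
        (V ((extChartAt 𝓘(ℝ, E).tangent p).symm z)))).2 := by
  set q := (extChartAt 𝓘(ℝ, E).tangent p).symm z
  have hqs : q ∈ (chartAt (ModelProd E E) p).source := by
    rw [← extChartAt_source 𝓘(ℝ, E).tangent]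
    exact (extChartAt 𝓘(ℝ, E).tangent p).map_target hz
  have h1 := ContinuousLinearMap.inverse_eq
    (mfderivWithin_extChartAt_symm_comp_mfderiv_extChartAt hz)
    (mfderiv_extChartAt_comp_mfderivWithin_extChartAt_symm hz)
  have h4 := (trivializationAt (E × E) (TangentSpace 𝓘(ℝ, E).tangent)
    p).continuousLinearMapAt_apply_of_mem (R := ℝ) (b := q) hqs (V q)
  rw [TangentBundle.continuousLinearMapAt_trivializationAt hqs] at h4
  exact (congrArg (fun L : E × E →L[ℝ] E × E => L (V q)) h1).trans h4

lemma inverse_apply_of_eq_id {F : Type*} [NormedAddCommGroup F] [NormedSpace ℝ F]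
    {L : F →L[ℝ] F} (hL : L = ContinuousLinearMap.id ℝ F) (x : F) : L.inverse x = x := by
  rw [hL, ContinuousLinearMap.inverse_id, ContinuousLinearMap.id_apply]

/-- In the chart at `v` the bracket is `DS(C) - DC(S)`, where `DC(S) = (0, S₂)`, and `DS(C)` is the
derivative of `S` along the ray through `v`. -/
lemma Spray.hasDerivAt_of_isHomogeneous {S : Spray E M} {m : ℝ≥0} (hS : S.IsHomogeneous m)
    (v : TM E M) :
    HasDerivAt (fun r : ℝ => S.val (smulTM r v))
      (((m : ℝ) - 1) • S.val v + ((0 : E), (S.val v).2)) 1 := by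
  set J := 𝓘(ℝ, E).tangent with hJ
  set Φ := extChartAt J v with hΦ
  have hrange : range J = univ := J.range_eq_univ
  set V : E × E → E × E := VectorField.mpullbackWithin 𝓘(ℝ, E × E) J Φ.symm
      (fun v => euler E M v) (range J) with hV
  set W : E × E → E × E := VectorField.mpullbackWithin 𝓘(ℝ, E × E) J Φ.symm
      (fun v => S.toFun v) (range J) with hW
  have htgt : Φ.target ∈ 𝓝 (Φ v) := extChartAt_target_mem_nhds v
  have hVe : V =ᶠ[𝓝 (Φ v)] fun z => ((0 : E), z.2) := by
    filter_upwards [htgt] with z hz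
    have h1 := mpullbackWithin_extChartAt_symm v (euler E M) hz
    refine h1.trans ?_
    rw [euler_eq, trivializationAt_vertical]
    · have h2 : Φ (Φ.symm z) = z := Φ.right_inv hz
      rw [hΦ, extChartAt_tangent_apply] at h2
      exact congrArg (fun z : E × E => ((0 : E), z.2)) h2
    · have := Φ.map_target hz
      rw [hΦ, extChartAt_source] at this
      exact (TangentBundle.mem_chart_source_iff _ _).1 this
  have hWe : W =ᶠ[𝓝 (Φ v)] fun z => (trivializationAt (E × E) (TangentSpace 𝓘(ℝ, E).tangent) v
      (mkTTM (Φ.symm z) (S.val (Φ.symm z)))).2 := by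
    filter_upwards [htgt] with z hz using mpullbackWithin_extChartAt_symm v S.val hz
  have hWd : DifferentiableAt ℝ W (Φ v) := by
    rw [hWe.differentiableAt_iff]
    have h1 : ContMDiffAt 𝓘(ℝ, E × E) J ∞ Φ.symm (Φ v) := by
      have := contMDiffWithinAt_extChartAt_symm_range (I := J) (n := ∞) v (mem_extChartAt_target v)
      rwa [hrange, contMDiffWithinAt_univ] at this
    have h2 : ContMDiffAt J 𝓘(ℝ, E × E) ∞ (fun w =>
      (trivializationAt (E × E) (TangentSpace 𝓘(ℝ, E).tangent) v (mkTTM w (S.val w))).2)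
      (Φ.symm (Φ v)) := by
      rw [Φ.left_inv (mem_extChartAt_source v)]
      exact S.contMDiffAt_trivializationAt v
    have h3 := h2.comp (Φ v) h1
    exact (h3.mdifferentiableAt (by simp)).differentiableAt
  have hv : Φ v = (extChartAt 𝓘(ℝ, E) v.proj v.proj, fib v) := by
    rw [hΦ, extChartAt_tangent_apply, trivializationAt_self]
  have hbr : (VectorField.lieBracketWithin ℝ V W (Φ.symm ⁻¹' univ ∩ range J) (Φ v)) =
      ((m : ℝ) - 1) • S.val v := by
    have h1 := hS v
    rw [VectorField.mlieBracket, VectorField.mlieBracketWithin_apply] at h1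
    have h2 : (mfderiv J 𝓘(ℝ, E × E) Φ v : E × E →L[ℝ] E × E) = ContinuousLinearMap.id ℝ _ :=
      mfderiv_extChartAt_self
    exact (inverse_apply_of_eq_id h2 _).symm.trans h1
  rw [hrange, preimage_univ, inter_univ, VectorField.lieBracketWithin_univ,
    VectorField.lieBracket, hVe.fderiv_eq, hVe.eq_of_nhds] at hbr
  have hWv : W (Φ v) = S.val v := by
    rw [hWe.eq_of_nhds, Φ.left_inv (mem_extChartAt_source v), trivializationAt_mkTTM rfl]
  have hfd : fderiv ℝ (fun z : E × E => ((0 : E), z.2)) (Φ v) (W (Φ v)) =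
      ((0 : E), (S.val v).2) := by
    have : HasFDerivAt (fun z : E × E => ((0 : E), z.2))
      (ContinuousLinearMap.prod (0 : E × E →L[ℝ] E) (ContinuousLinearMap.snd ℝ E E)) (Φ v) :=
      ((0 : E × E →L[ℝ] E).prod (ContinuousLinearMap.snd ℝ E E)).hasFDerivAt
    rw [this.fderiv, hWv]
    simp
  rw [hfd, sub_eq_iff_eq_add] at hbr
  have hline : HasDerivAt (fun r : ℝ => ((Φ v).1, r • fib v)) ((0 : E), (Φ v).2) 1 := by
    have := (hasDerivAt_const (1 : ℝ) (Φ v).1).prodMk ((hasDerivAt_id (1 : ℝ)).smul_const (fib v))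
    simpa [hv] using this
  have h1 : ((Φ v).1, (1 : ℝ) • fib v) = Φ v := by rw [hv, one_smul]
  have hcomp := HasFDerivAt.comp_hasDerivAt (1 : ℝ) (f := fun r : ℝ => ((Φ v).1, r • fib v))
    (l := W) (l' := fderiv ℝ W (Φ v)) (by rw [h1]; exact hWd.hasFDerivAt) hline
  rw [hbr] at hcomp
  refine hcomp.congr_of_eventuallyEq ?_
  have hcont := hline.continuousAt.tendsto
  rw [h1] at hcont
  filter_upwards [hcont.eventually hWe] with r hr
  have h2 : ((Φ v).1, r • fib v) = Φ (smulTM r v) := by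
    rw [hΦ, extChartAt_tangent_apply, extChartAt_tangent_apply,
      trivializationAt_smul _ _ (mem_chart_source _ _), trivializationAt_self]
    rfl
  have h3 : smulTM r v ∈ Φ.source := by
    rw [hΦ, extChartAt_source]
    simp
  rw [Function.comp_apply, hr, h2, Φ.left_inv h3]
  exact (trivializationAt_mkTTM (p := v) (q := smulTM r v) rfl _).symm

/-- A smooth curve `g` in a normed space with `r g'(r) = 2 g(r)` is quadratic. -/
lemma eq_sq_smul_of_smul_deriv_eq {F : Type*} [NormedAddCommGroup F] [NormedSpace ℝ F]
    {g : ℝ → F} (hg : ContDiff ℝ ∞ g) (h : ∀ r, r • deriv g r = (2 : ℝ) • g r) (r : ℝ) :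
    g r = r ^ 2 • g 1 := by
  have hg1 : ContDiff ℝ ∞ (deriv g) := (contDiff_infty_iff_deriv.1 hg).2
  have hg2 : ContDiff ℝ ∞ (deriv (deriv g)) := (contDiff_infty_iff_deriv.1 hg1).2
  have hg3 : ContDiff ℝ ∞ (deriv (deriv (deriv g))) := (contDiff_infty_iff_deriv.1 hg2).2
  have hd (f : ℝ → F) (hf : ContDiff ℝ ∞ f) (r : ℝ) : HasDerivAt f (deriv f r) r :=
    (hf.differentiable (by simp) r).hasDerivAt
  have h1 : ∀ r, r • deriv (deriv g) r = deriv g r := by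
    intro r
    have e1 := (hasDerivAt_id r).smul (hd _ hg1 r)
    have e2 := (hd g hg r).const_smul (2 : ℝ)
    have e3 : (id : ℝ → ℝ) • deriv g = (2 : ℝ) • g := by
      ext1 s
      exact h s
    rw [e3] at e1
    have e4 := e1.unique e2
    rw [one_smul, two_smul] at e4
    exact add_right_cancel e4
  have h2 : ∀ r, r • deriv (deriv (deriv g)) r = 0 := by
    intro r
    have e1 := (hasDerivAt_id r).smul (hd _ hg2 r)
    have e2 := hd _ hg1 r
    have e3 : (id : ℝ → ℝ) • deriv (deriv g) = deriv g := by
      ext1 s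
      exact h1 s
    rw [e3] at e1
    have e4 := e1.unique e2
    rw [one_smul] at e4
    simpa using e4
  have h3 : ∀ r, r ≠ 0 → deriv (deriv (deriv g)) r = 0 := fun r hr =>
    (smul_eq_zero.1 (h2 r)).resolve_left hr
  -- Smoothness at `0` matters here: without it the two half-lines could carry different quadratic
  -- coefficients.
  have h4 : ∀ r, deriv (deriv (deriv g)) r = 0 := by
    intro r
    by_cases hr : r = 0
    · subst hr
      have t1 : Tendsto (deriv (deriv (deriv g))) (𝓝[≠] 0) (𝓝 (deriv (deriv (deriv g)) 0)) :=
        hg3.continuous.continuousAt.tendsto.mono_left nhdsWithin_le_nhds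
      have t2 : Tendsto (deriv (deriv (deriv g))) (𝓝[≠] (0 : ℝ)) (𝓝 0) :=
        tendsto_const_nhds.congr' (by
          filter_upwards [self_mem_nhdsWithin] with s hs using (h3 s hs).symm)
      exact tendsto_nhds_unique t1 t2
    · exact h3 r hr
  have h5 : deriv (deriv g) r = deriv (deriv g) 1 :=
    is_const_of_deriv_eq_zero (hg2.differentiable (by simp)) h4 r 1
  have h6 : ∀ s, g s = (2⁻¹ * s ^ 2 : ℝ) • deriv (deriv g) s := by
    intro s
    have e := h s
    rw [← h1 s, smul_smul] at e
    rw [mul_smul, pow_two, e, smul_smul]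
    norm_num
  rw [h6 r, h6 1, h5, smul_smul]
  congr 1
  ring

/-- The bracket identity at `r v` is the Euler equation of degree `2` for the second component along
the ray, and a solution smooth at `0` is quadratic. The case of negative `r` gives reversibility of
geodesics. -/
lemma Spray.val_smulTM {S : Spray E M} {m : ℝ≥0} (hS : S.IsHomogeneous m) (r : ℝ) (v : TM E M) :
    S.val (smulTM r v) = (r • fib v, r ^ 2 • (S.val v).2) := by
  refine Prod.ext (S.fst_eq _) ?_
  rcases subsingleton_or_nontrivial E with hE | hE
  · exact Subsingleton.elim _ _
  obtain ⟨y, hy⟩ := exists_ne (0 : E)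
  -- The first component of `S` is the vector itself, so its derivative along the ray through `y` is
  -- `y`, while the bracket gives `(m - 1) y`.
  have hm : (m : ℝ) = 2 := by
    have h1 := (S.hasDerivAt_of_isHomogeneous hS (mkTM v.proj y)).fst
    simp only [S.fst_eq, fib_smulTM, fib_mkTM] at h1
    have h2 : HasDerivAt (fun r : ℝ => r • y) ((1 : ℝ) • y) 1 :=
      (hasDerivAt_id (1 : ℝ)).smul_const y
    have h3 := HasDerivAt.unique h1 h2
    rw [Prod.fst_add, Prod.smul_fst, S.fst_eq, fib_mkTM, add_zero] at h3
    have h4 := smul_left_injective ℝ hy h3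
    linarith
  have h := eq_sq_smul_of_smul_deriv_eq (g := fun r => (S.val (smulTM r v)).2)
    (contDiff_snd.comp (S.contDiff_ray v)) ?_ r
  · simpa using h
  intro r
  have h1 : HasDerivAt (fun s : ℝ => (S.val (smulTM s (smulTM r v))).2) _ 1 :=
    (S.hasDerivAt_of_isHomogeneous hS (smulTM r v)).snd
  simp only [smulTM_smulTM] at h1
  have h2 : HasDerivAt (fun s : ℝ => s * r) (1 * r) 1 := (hasDerivAt_id (1 : ℝ)).mul_const r
  have h3 : HasDerivAt (fun r => (S.val (smulTM r v)).2)
      (deriv (fun r => (S.val (smulTM r v)).2) (1 * r)) (1 * r) :=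
    ((contDiff_snd.comp (S.contDiff_ray v)).differentiable (by simp) _).hasDerivAt
  have h4 := HasDerivAt.scomp (1 : ℝ) h3 h2
  have h5 := h4.unique h1
  rw [one_mul] at h5
  rw [h5, hm]
  simp only [Prod.snd_add, Prod.smul_snd]
  rw [two_smul]
  norm_num

end Homogeneity

/-! ### The metric as a function on the tangent bundle -/

section Metric

variable {E : Type*} [NormedAddCommGroup E] [NormedSpace ℝ E]
  {M : Type*} [TopologicalSpace M] [ChartedSpace E M] [IsManifold 𝓘(ℝ, E) ∞ M]

instance [T2Space M] : T2Space (TM E M) := by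
  refine ⟨fun v w hvw => ?_⟩
  have hc := FiberBundle.continuous_proj E (TangentSpace 𝓘(ℝ, E) : M → Type _)
  by_cases h : v.proj = w.proj
  · set e := trivializationAt E (TangentSpace 𝓘(ℝ, E)) v.proj
    have hv : v ∈ e.source := e.mem_source.2 (mem_chart_source E v.proj)
    have hw : w ∈ e.source := e.mem_source.2 (h ▸ mem_chart_source E v.proj)
    obtain ⟨a, b, ha, hb, hva, hwb, hab⟩ := t2_separation (e.injOn.ne hv hw hvw)
    refine ⟨e.source ∩ e ⁻¹' a, e.source ∩ e ⁻¹' b, e.continuousOn.isOpen_inter_preimage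
      e.open_source ha, e.continuousOn.isOpen_inter_preimage e.open_source hb, ⟨hv, hva⟩,
      ⟨hw, hwb⟩, ?_⟩
    exact (hab.preimage e).mono inter_subset_right inter_subset_right
  · obtain ⟨a, b, ha, hb, hva, hwb, hab⟩ := t2_separation h
    exact ⟨_, _, ha.preimage hc, hb.preimage hc, hva, hwb, hab.preimage _⟩

variable (h : RMetric E M)

/-- The squared length of tangent vectors for a Riemannian metric, as a function on `TM`. -/
def normSq (v : TM E M) : ℝ := h.inner v.proj v.snd v.snd

lemma normSq_smulTM (c : ℝ) (v : TM E M) : normSq h (smulTM c v) = c ^ 2 * normSq h v := by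
  have h1 : normSq h (smulTM c v) = h.inner v.proj (c • v.snd) (c • v.snd) := rfl
  rw [h1, map_smul, map_smul, smul_apply, smul_eq_mul, smul_eq_mul, normSq]
  ring

lemma normSq_pos {v : TM E M} (hv : fib v ≠ 0) : 0 < normSq h v := h.pos v.proj v.snd hv

lemma contMDiff_normSq : ContMDiff 𝓘(ℝ, E).tangent 𝓘(ℝ, ℝ) ∞ (normSq h) := by
  let : RiemannianBundle (fun x : M => TangentSpace 𝓘(ℝ, E) x) := ⟨h.toRiemannianMetric⟩
  exact ContMDiff.inner_bundle (IB := 𝓘(ℝ, E)) (F := E)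
    (E := fun x : M => TangentSpace 𝓘(ℝ, E) x) (b := fun v : TM E M => v.proj)
    (v := fun v => v.snd) (w := fun v => v.snd) contMDiff_id contMDiff_id

lemma continuous_normSq : Continuous (normSq h) := (contMDiff_normSq h).continuous

lemma mdifferentiableAt_normSq (v : TM E M) :
    MDifferentiableAt 𝓘(ℝ, E).tangent 𝓘(ℝ, ℝ) (normSq h) v :=
  (contMDiff_normSq h).mdifferentiable (by simp) v

/-- The differential of the squared length. -/
def dNormSq (v : TM E M) : E × E →L[ℝ] ℝ := mfderiv 𝓘(ℝ, E).tangent 𝓘(ℝ, ℝ) (normSq h) v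

lemma HasVelocityAt.hasDerivAt_normSq {γ : ℝ → TM E M} {w : E × E} {t : ℝ}
    (hγ : HasVelocityAt 𝓘(ℝ, E).tangent γ w t) :
    HasDerivAt (fun s => normSq h (γ s)) (dNormSq h (γ t) w) t :=
  hγ.hasDerivAt_comp (mdifferentiableAt_normSq h _)

/-- Euler's identity for a quadratic function. -/
lemma dNormSq_vertical (v : TM E M) : dNormSq h v ((0 : E), fib v) = 2 * normSq h v := by
  have h1 := (hasVelocityAt_ray v 1).hasDerivAt_normSq h
  have h2 : HasDerivAt (fun s : ℝ => s ^ 2 * normSq h v) (2 * normSq h v) 1 := by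
    simpa using (hasDerivAt_pow 2 (1 : ℝ)).mul_const (normSq h v)
  simp only [normSq_smulTM] at h1
  rw [smulTM_one] at h1
  exact h1.unique h2

lemma continuous_dNormSq : Continuous (fun ξ : TTM E M => dNormSq h ξ.proj ξ.snd) := by
  have h1 := ContMDiff.contMDiff_tangentMap (contMDiff_normSq h) (m := 0) (by simp)
  exact (contMDiff_snd_tangentBundle_modelSpace (n := 0) ℝ 𝓘(ℝ, ℝ)).continuous.comp h1.continuous

lemma trivializationAt_sub_smul_vertical {p q : TM E M}
    (hq : q.proj ∈ (chartAt E p.proj).source) (w : E × E) (c : ℝ) :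
    (trivializationAt (E × E) (TangentSpace 𝓘(ℝ, E).tangent) p
      (mkTTM q (w - c • ((0 : E), fib q)))).2 =
    (trivializationAt (E × E) (TangentSpace 𝓘(ℝ, E).tangent) p (mkTTM q w)).2 -
      c • ((0 : E), (trivializationAt E (TangentSpace 𝓘(ℝ, E)) p.proj q).2) := by
  have hq' : q ∈ (chartAt (ModelProd E E) p).source :=
    (TangentBundle.mem_chart_source_iff _ _).2 hq
  have hl : IsLinearMap ℝ fun w : E × E =>
      (trivializationAt (E × E) (TangentSpace 𝓘(ℝ, E).tangent) p (mkTTM q w)).2 :=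
    (trivializationAt (E × E) (TangentSpace 𝓘(ℝ, E).tangent) p).linear ℝ hq'
  have h3 : (trivializationAt (E × E) (TangentSpace 𝓘(ℝ, E).tangent) p
      (mkTTM q ((0 : E), fib q))).2 = _ := trivializationAt_vertical p q hq
  rw [hl.map_sub, hl.map_smul, h3]

/-- The set of the unit vectors over a set of base points. -/
def unitOver (A : Set M) : Set (TM E M) := {v | v.proj ∈ A ∧ normSq h v = 1}

lemma eventually_norm_trivializationAt_sq_le [FiniteDimensional ℝ E] (x : M) :
    ∃ C : ℝ, ∀ᶠ y in 𝓝 x, ∀ v : TM E M, v.proj = y →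
      ‖(trivializationAt E (TangentSpace 𝓘(ℝ, E)) x v).2‖ ^ 2 ≤ C * normSq h v := by
  let : RiemannianBundle (fun x : M => TangentSpace 𝓘(ℝ, E) x) := ⟨h.toRiemannianMetric⟩
  have : IsContinuousRiemannianBundle E (fun x : M => TangentSpace 𝓘(ℝ, E) x) :=
    ⟨h.inner, h.contMDiff.continuous, fun _ _ _ => rfl⟩
  obtain ⟨C, hC, hx⟩ := eventually_norm_trivializationAt_lt E
    (fun x : M => TangentSpace 𝓘(ℝ, E) x) x
  refine ⟨C ^ 2, ?_⟩
  filter_upwards [hx, (chartAt E x).open_source.mem_nhds (mem_chart_source E x)] with y hy hys v hv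
  subst hv
  have h1 : ‖(trivializationAt E (TangentSpace 𝓘(ℝ, E)) x).continuousLinearMapAt ℝ v.proj v.snd‖ ≤
      C * ‖v.snd‖ := (ContinuousLinearMap.le_opNorm _ _).trans (by gcongr)
  have h3 := (trivializationAt E (TangentSpace 𝓘(ℝ, E)) x).continuousLinearMapAt_apply_of_mem
    (R := ℝ) (b := v.proj) hys v.snd
  rw [h3] at h1
  have h2 : normSq h v = ‖v.snd‖ ^ 2 := (real_inner_self_eq_norm_sq v.snd)
  rw [h2, ← mul_pow]
  exact pow_le_pow_left₀ (norm_nonneg _) h1 2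

/-- The base points of an ultrafilter converge in `A`, and near the limit the metric dominates the
coordinate norm, so the fibre coordinates converge too. -/
lemma isCompact_unitOver [FiniteDimensional ℝ E] {A : Set M} (hA : IsCompact A) :
    IsCompact (unitOver h A) := by
  rw [isCompact_iff_ultrafilter_le_nhds]
  intro f hf
  have hfA : ∀ᶠ v in (f : Filter (TM E M)), v.proj ∈ A ∧ normSq h v = 1 := le_principal_iff.1 hf
  obtain ⟨x, hxA, hx⟩ := isCompact_iff_ultrafilter_le_nhds.1 hA (f.map TotalSpace.proj)
    (le_principal_iff.2 (hfA.mono fun v hv => hv.1))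
  set e := trivializationAt E (TangentSpace 𝓘(ℝ, E)) x with he
  obtain ⟨C, hC⟩ := eventually_norm_trivializationAt_sq_le h x
  have hb : ∀ᶠ v in (f : Filter (TM E M)), (e v).2 ∈ Metric.closedBall (0 : E) (C + 1) := by
    filter_upwards [hfA, hx hC] with v hv1 hv2
    have h1 := hv2 v rfl
    rw [hv1.2, mul_one] at h1
    rw [mem_closedBall_zero_iff]
    nlinarith [sq_nonneg (‖(e v).2‖ - 1)]
  obtain ⟨y, -, hy⟩ := isCompact_iff_ultrafilter_le_nhds.1
    (isCompact_closedBall (0 : E) (C + 1)) (f.map fun v => (e v).2) (le_principal_iff.2 hb)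
  have hsrc : ∀ᶠ v in (f : Filter (TM E M)), v ∈ e.source := by
    filter_upwards [hx ((chartAt E x).open_source.mem_nhds (mem_chart_source E x))] with v hv
    exact e.mem_source.2 hv
  have ht : Tendsto (fun v => (v.proj, (e v).2)) (f : Filter (TM E M)) (𝓝 (x, y)) :=
    Tendsto.prodMk_nhds hx hy
  have hxy : (x, y) ∈ e.target := e.mem_target.2 (mem_chart_source E x)
  have ht2 : Tendsto (fun v => e.toOpenPartialHomeomorph.symm (v.proj, (e v).2))
      (f : Filter (TM E M)) (𝓝 (e.toOpenPartialHomeomorph.symm (x, y))) :=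
    (e.toOpenPartialHomeomorph.symm.continuousAt hxy).tendsto.comp ht
  have hlim : (f : Filter (TM E M)) ≤ 𝓝 (e.toOpenPartialHomeomorph.symm (x, y)) := by
    refine (ht2.congr' ?_ : Tendsto id _ _)
    filter_upwards [hsrc] with v hv
    have h1 : (v.proj, (e v).2) = e v := Prod.ext (e.coe_fst hv).symm rfl
    rw [h1]
    exact e.toOpenPartialHomeomorph.left_inv hv
  refine ⟨_, ⟨?_, ?_⟩, hlim⟩
  · have : (e.toOpenPartialHomeomorph.symm (x, y)).proj = x := e.proj_symm_apply hxy
    rwa [this]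
  · exact tendsto_nhds_unique ((continuous_normSq h).continuousAt.tendsto.mono_left hlim)
      (tendsto_const_nhds.congr' (hfA.mono fun v hv => hv.2.symm))

end Metric

/-! ### Reparametrizations of intervals -/

lemma IsOpenInterval.image {J : Set ℝ} (hJ : IsOpenInterval J) {f : ℝ → ℝ}
    (hc : ContinuousOn f J) (hm : StrictMonoOn f J) : IsOpenInterval (f '' J) := by
  have hpre := (hJ.2.1.isPreconnected.image f hc).ordConnected
  refine ⟨?_, hpre, hJ.2.2.image f⟩
  rw [isOpen_iff_mem_nhds]
  rintro _ ⟨t, ht, rfl⟩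
  obtain ⟨ε, hε, hb⟩ := Metric.isOpen_iff.1 hJ.1 t ht
  have h1 : t - ε / 2 ∈ J := hb (by rw [Metric.mem_ball, Real.dist_eq]; simp [abs_of_pos, hε])
  have h2 : t + ε / 2 ∈ J := hb (by rw [Metric.mem_ball, Real.dist_eq]; simp [abs_of_pos, hε])
  refine mem_of_superset (Ioo_mem_nhds (hm h1 ht (by linarith)) (hm ht h2 (by linarith))) ?_
  exact Ioo_subset_Icc_self.trans (hpre.out ⟨_, h1, rfl⟩ ⟨_, h2, rfl⟩)

/-- A function with positive derivative on an open interval has a differentiable inverse. -/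
lemma exists_hasDerivAt_inverse {J : Set ℝ} (hJ : IsOpenInterval J) {f f' : ℝ → ℝ}
    (hf : ∀ t ∈ J, HasDerivAt f (f' t) t) (hpos : ∀ t ∈ J, 0 < f' t) :
    StrictMonoOn f J ∧ IsOpenInterval (f '' J) ∧ ∃ g : ℝ → ℝ, (∀ t ∈ J, g (f t) = t) ∧
      ∀ t ∈ J, HasDerivAt g (f' t)⁻¹ (f t) := by
  have hc : ContinuousOn f J := fun t ht => (hf t ht).continuousAt.continuousWithinAt
  have hm : StrictMonoOn f J := by
    refine strictMonoOn_of_deriv_pos hJ.2.1.convex hc fun t ht => ?_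
    rw [hJ.1.interior_eq] at ht
    rw [(hf t ht).deriv]
    exact hpos t ht
  have hi := hJ.image hc hm
  refine ⟨hm, hi, Function.invFunOn f J, ?_, ?_⟩
  · exact fun t ht => hm.injOn.leftInvOn_invFunOn ht
  intro t ht
  set g := Function.invFunOn f J with hg
  have hgf : ∀ t ∈ J, g (f t) = t := fun t ht => hm.injOn.leftInvOn_invFunOn ht
  have hgm : StrictMonoOn g (f '' J) := by
    rintro _ ⟨a, ha, rfl⟩ _ ⟨b, hb, rfl⟩ hab
    rw [hgf a ha, hgf b hb]
    exact (hm.lt_iff_lt ha hb).1 hab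
  have hgi : g '' (f '' J) = J := by
    ext x
    simp only [mem_image, exists_exists_and_eq_and]
    constructor
    · rintro ⟨a, ha, rfl⟩
      rwa [hgf a ha]
    · exact fun hx => ⟨x, hx, hgf x hx⟩
  have hgc : ContinuousAt g (f t) := by
    refine hgm.continuousAt_of_image_mem_nhds (hi.1.mem_nhds ⟨t, ht, rfl⟩) ?_
    rw [hgi, hgf t ht]
    exact hJ.1.mem_nhds ht
  refine HasDerivAt.of_local_left_inverse hgc (by rw [hgf t ht]; exact hf t ht) (hpos t ht).ne' ?_
  filter_upwards [hi.1.mem_nhds ⟨t, ht, rfl⟩]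
  rintro _ ⟨a, ha, rfl⟩
  rw [hgf a ha]

lemma exists_primitive {J : Set ℝ} (hJ : IsOpenInterval J) {f : ℝ → ℝ} (hf : ContinuousOn f J)
    {t₀ : ℝ} (ht₀ : t₀ ∈ J) : ∃ F : ℝ → ℝ, F t₀ = 0 ∧ ∀ t ∈ J, HasDerivAt F (f t) t := by
  refine ⟨fun t => ∫ x in t₀..t, f x, intervalIntegral.integral_same, fun t ht => ?_⟩
  refine intervalIntegral.integral_hasDerivAt_right ?_ ?_ ?_
  · exact (hf.mono (hJ.2.1.uIcc_subset ht₀ ht)).intervalIntegrable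
  · exact hf.stronglyMeasurableAtFilter hJ.1 t ht
  · exact hf.continuousAt (hJ.1.mem_nhds ht)

/-! ### Local estimates for curves with nearly constant velocity -/

section LocalEstimate

variable {F H N : Type*} [NormedAddCommGroup F] [NormedSpace ℝ F] [TopologicalSpace H]
  {I : ModelWithCorners ℝ F H} [TopologicalSpace N] [ChartedSpace H N]

/-- A velocity can be recognized from a linear approximation in a chart. -/
lemma hasVelocityAt_of_eventually_le [I.Boundaryless] {γ : ℝ → N} {w : F} {s : ℝ}
    (h : ∀ ε > 0, ∀ᶠ t in 𝓝 s, γ t ∈ (extChartAt I (γ s)).source ∧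
      ‖extChartAt I (γ s) (γ t) - extChartAt I (γ s) (γ s) - (t - s) • w‖ ≤ ε * ‖t - s‖) :
    HasVelocityAt I γ w s := by
  have hd : HasDerivAt (fun t => extChartAt I (γ s) (γ t)) w s := by
    rw [hasDerivAt_iff_isLittleO, Asymptotics.isLittleO_iff]
    exact fun ε hε => (h ε hε).mono fun t ht => ht.2
  refine ⟨?_, hd⟩
  have h1 := (continuousAt_extChartAt_symm (I := I) (γ s)).tendsto.comp hd.continuousAt.tendsto
  rw [extChartAt_to_inv] at h1
  refine Tendsto.congr' ?_ h1
  filter_upwards [h 1 one_pos] with t ht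
  exact (extChartAt I (γ s)).left_inv ht.1

variable [FiniteDimensional ℝ F]

/-- The set is closed in all of `N`, not only in the chart domain, because it is the image of a
compact ball in a Hausdorff space. -/
lemma isClosed_chart_closedBall [T2Space N] {p : N} {r : ℝ}
    (hr : Metric.closedBall (extChartAt I p p) r ⊆ (extChartAt I p).target) :
    IsClosed ((extChartAt I p).source ∩
      extChartAt I p ⁻¹' Metric.closedBall (extChartAt I p p) r) := by
  have : ProperSpace F := FiniteDimensional.proper ℝ F
  have h1 : (extChartAt I p).source ∩ extChartAt I p ⁻¹' Metric.closedBall (extChartAt I p p) r =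
      (extChartAt I p).symm '' Metric.closedBall (extChartAt I p p) r := by
    rw [← (extChartAt I p).symm_image_eq_source_inter_preimage hr]
  rw [h1]
  exact ((isCompact_closedBall _ _).image_of_continuousOn
    ((continuousOn_extChartAt_symm p).mono hr)).isClosed

/-- A mean value inequality by continuous induction: the derivative is controlled only while the
curve is in the chart ball, so staying in the ball and the estimate must be proved together. -/
lemma local_estimate_right [T2Space N] {p : N} {r : ℝ} (hr0 : 0 < r)
    (hr : Metric.closedBall (extChartAt I p p) r ⊆ (extChartAt I p).target)
    {γ : ℝ → N} {w : F} {ε a b : ℝ} (hab : a ≤ b) (hε : 0 < ε)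
    (hb : (b - a) * (‖w‖ + ε) ≤ r / 4) (hγ : ∀ t ∈ Icc a b, ContinuousAt γ t)
    (ha : γ a ∈ (extChartAt I p).source)
    (ha' : ‖extChartAt I p (γ a) - extChartAt I p p‖ ≤ r / 2)
    (hd : ∀ t ∈ Icc a b, γ t ∈ (extChartAt I p).source →
      ‖extChartAt I p (γ t) - extChartAt I p p‖ ≤ r →
      ∃ w' : F, HasDerivAt (fun s => extChartAt I p (γ s)) w' t ∧ ‖w' - w‖ < ε) :
    γ b ∈ (extChartAt I p).source ∧ ‖extChartAt I p (γ b) - extChartAt I p p‖ ≤ r ∧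
      ‖extChartAt I p (γ b) - extChartAt I p (γ a) - (b - a) • w‖ ≤ ε * (b - a) := by
  set φ := extChartAt I p with hφ
  set C := φ.source ∩ φ ⁻¹' Metric.closedBall (φ p) r with hC
  have hCc : IsClosed C := isClosed_chart_closedBall hr
  set s : Set ℝ := {t | γ t ∈ C ∧ ‖φ (γ t) - φ (γ a) - (t - a) • w‖ ≤ ε * (t - a)} with hs
  have hγ' : ContinuousOn γ (Icc a b) := fun t ht => (hγ t ht).continuousWithinAt
  have hclosed : IsClosed (s ∩ Icc a b) := by
    have h1 : IsClosed (Icc a b ∩ γ ⁻¹' C) := hγ'.preimage_isClosed_of_isClosed isClosed_Icc hCc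
    have h2 : ContinuousOn (fun t => φ (γ t)) (Icc a b ∩ γ ⁻¹' C) :=
      (continuousOn_extChartAt p).comp (hγ'.mono inter_subset_left) fun t ht => ht.2.1
    have h3 : ContinuousOn (fun t => ‖φ (γ t) - φ (γ a) - (t - a) • w‖) (Icc a b ∩ γ ⁻¹' C) :=
      ((h2.sub continuousOn_const).sub (by fun_prop)).norm
    have h4 := h1.isClosed_le h3 (g := fun t => ε * (t - a)) (by fun_prop)
    convert! h4 using 1
    ext t
    simp only [hs, mem_inter_iff, mem_ofPred_eq, mem_preimage]
    tauto
  have hsub : Icc a b ⊆ s := by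
    refine hclosed.Icc_subset_of_forall_exists_gt ?_ ?_
    · refine ⟨⟨ha, ?_⟩, by simp⟩
      rw [mem_preimage, mem_closedBall_iff_norm]
      linarith
    · rintro t ⟨⟨⟨hts, htr⟩, hte⟩, hta, htb⟩ y hy
      rw [mem_preimage, mem_closedBall_iff_norm] at htr
      have htI : t ∈ Icc a b := ⟨hta, htb.le⟩
      obtain ⟨w', hw', hww⟩ := hd t htI hts htr
      -- The curve starts within `r / 2` and has travelled at most `r / 4`, so it is strictly inside
      -- the ball and remains there a little longer.
      have hstrict : ‖φ (γ t) - φ p‖ < r := by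
        have e1 : φ (γ t) - φ p =
            (φ (γ t) - φ (γ a) - (t - a) • w) + (t - a) • w + (φ (γ a) - φ p) := by abel
        have e2 : ‖(t - a) • w‖ = (t - a) * ‖w‖ := by
          rw [norm_smul, Real.norm_of_nonneg (by linarith)]
        have e3 : (t - a) * (‖w‖ + ε) ≤ (b - a) * (‖w‖ + ε) := by
          gcongr
        calc ‖φ (γ t) - φ p‖ ≤ ‖φ (γ t) - φ (γ a) - (t - a) • w‖ + ‖(t - a) • w‖ +
              ‖φ (γ a) - φ p‖ := by rw [e1]; exact norm_add₃_le
          _ ≤ ε * (t - a) + (t - a) * ‖w‖ + r / 2 := by rw [e2]; gcongr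
          _ < r := by nlinarith
      have hnear : ∀ᶠ x in 𝓝 t, γ x ∈ C := by
        have o1 : ∀ᶠ x in 𝓝 t, γ x ∈ φ.source :=
          (hγ t htI).eventually_mem ((isOpen_extChartAt_source p).mem_nhds hts)
        have o2 : ∀ᶠ x in 𝓝 t, φ (γ x) ∈ Metric.ball (φ p) r :=
          hw'.continuousAt.eventually_mem (Metric.isOpen_ball.mem_nhds
            (by rwa [mem_ball_iff_norm]))
        filter_upwards [o1, o2] with x h1 h2 using ⟨h1, Metric.ball_subset_closedBall h2⟩
      -- The strict inequality `‖w' - w‖ < ε` leaves room for the error of the linear approximation.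
      have hder : ∀ᶠ x in 𝓝 t, ‖φ (γ x) - φ (γ t) - (x - t) • w'‖ ≤ (ε - ‖w' - w‖) * ‖x - t‖ := by
        rw [hasDerivAt_iff_isLittleO, Asymptotics.isLittleO_iff] at hw'
        exact hw' (by linarith)
      have hgt : ∀ᶠ x in 𝓝[>] t, x ∈ s := by
        filter_upwards [nhdsWithin_le_nhds hnear, nhdsWithin_le_nhds hder, self_mem_nhdsWithin]
          with x h1 h2 (h3 : t < x)
        refine ⟨h1, ?_⟩
        rw [Real.norm_of_nonneg (by linarith)] at h2
        have e1 : φ (γ x) - φ (γ a) - (x - a) • w = (φ (γ x) - φ (γ t) - (x - t) • w') +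
            (x - t) • (w' - w) + (φ (γ t) - φ (γ a) - (t - a) • w) := by
          module
        have e2 : ‖(x - t) • (w' - w)‖ = (x - t) * ‖w' - w‖ := by
          rw [norm_smul, Real.norm_of_nonneg (by linarith)]
        calc ‖φ (γ x) - φ (γ a) - (x - a) • w‖ ≤ ‖φ (γ x) - φ (γ t) - (x - t) • w'‖ +
              ‖(x - t) • (w' - w)‖ + ‖φ (γ t) - φ (γ a) - (t - a) • w‖ := by
              rw [e1]; exact norm_add₃_le
          _ ≤ (ε - ‖w' - w‖) * (x - t) + (x - t) * ‖w' - w‖ + ε * (t - a) := by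
              rw [e2]; gcongr
          _ = ε * (x - a) := by ring
      have hIoc : ∀ᶠ x in 𝓝[>] t, x ∈ Ioc t y := Ioc_mem_nhdsGT hy
      exact (hgt.and hIoc).exists
  have hbs := hsub (right_mem_Icc.2 hab)
  refine ⟨hbs.1.1, ?_, hbs.2⟩
  have := hbs.1.2
  rwa [mem_preimage, mem_closedBall_iff_norm] at this

lemma local_estimate [T2Space N] {p : N} {r : ℝ} (hr0 : 0 < r)
    (hr : Metric.closedBall (extChartAt I p p) r ⊆ (extChartAt I p).target)
    {γ : ℝ → N} {w : F} {ε a b : ℝ} (hε : 0 < ε)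
    (hb : |b - a| * (‖w‖ + ε) ≤ r / 4) (hγ : ∀ t ∈ uIcc a b, ContinuousAt γ t)
    (ha : γ a ∈ (extChartAt I p).source)
    (ha' : ‖extChartAt I p (γ a) - extChartAt I p p‖ ≤ r / 2)
    (hd : ∀ t ∈ uIcc a b, γ t ∈ (extChartAt I p).source →
      ‖extChartAt I p (γ t) - extChartAt I p p‖ ≤ r →
      ∃ w' : F, HasDerivAt (fun s => extChartAt I p (γ s)) w' t ∧ ‖w' - w‖ < ε) :
    γ b ∈ (extChartAt I p).source ∧ ‖extChartAt I p (γ b) - extChartAt I p p‖ ≤ r ∧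
      ‖extChartAt I p (γ b) - extChartAt I p (γ a) - (b - a) • w‖ ≤ ε * |b - a| := by
  rcases le_total a b with hab | hab
  · rw [uIcc_of_le hab] at hγ hd
    rw [abs_of_nonneg (by linarith)] at hb ⊢
    exact local_estimate_right hr0 hr hab hε hb hγ ha ha' hd
  · rw [uIcc_of_ge hab] at hγ hd
    rw [abs_of_nonpos (by linarith)] at hb ⊢
    have := local_estimate_right (γ := fun t => γ (-t)) (w := -w) (a := -a) (b := -b) (ε := ε)
      hr0 hr (by linarith) hε (by rw [norm_neg]; convert! hb using 2; ring) ?_ (by simpa using ha)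
      (by simpa using ha') ?_
    · simp only [neg_neg] at this
      refine ⟨this.1, this.2.1, ?_⟩
      convert! this.2.2 using 2
      · module
      · ring
    · intro t ht
      exact ContinuousAt.comp (f := fun t : ℝ => -t) (hγ (-t) ⟨by linarith [ht.2], by linarith [ht.1]⟩)
        continuous_neg.continuousAt
    · intro t ht h1 h2
      obtain ⟨w', hw', hww⟩ := hd (-t) ⟨by linarith [ht.2], by linarith [ht.1]⟩ h1 h2
      refine ⟨-w', ?_, ?_⟩
      · have := HasDerivAt.scomp t hw' (hasDerivAt_neg t)
        simpa using! this
      · rwa [neg_sub_neg, norm_sub_rev]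

/-- Curves whose velocities are given by vector fields `V k` that are close to `w` near `p`, and
which are near `p` at times `s k` near `s₀`, are near `p` for a definite time. -/
lemma limit_estimate [T2Space N] [I.Boundaryless] [IsManifold I 1 N] {ι : Type*} {l : Filter ι}
    {u : ι → ℝ → N} {V : ι → N → F} {D : ι → Set ℝ} {Q : Set N}
    (hu : ∀ k, ∀ t ∈ D k, u k t ∈ Q ∧ HasVelocityAt I (u k) (V k (u k t)) t) {p : N} {w : F}
    (hV : ∀ ε > 0, ∃ U ∈ 𝓝 p, ∀ᶠ k in l, ∀ q ∈ U ∩ Q,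
      ‖(trivializationAt F (TangentSpace I) p ⟨q, V k q⟩).2 - w‖ < ε)
    {s : ι → ℝ} {s₀ : ℝ} (hs : Tendsto s l (𝓝 s₀)) (hp : Tendsto (fun k => u k (s k)) l (𝓝 p))
    {ε : ℝ} (hε : 0 < ε) {U : Set N} (hU : U ∈ 𝓝 p) :
    ∃ C : Set N, IsClosed C ∧ C ⊆ (extChartAt I p).source ∧ C ⊆ U ∧ ∃ δ > 0, ∀ t, |t - s₀| < δ →
      ∀ᶠ k in l, uIcc (s k) t ⊆ D k → u k t ∈ C ∧
        ‖extChartAt I p (u k t) - extChartAt I p (u k (s k)) - (t - s k) • w‖ ≤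
          ε * |t - s k| := by
  obtain ⟨U₁, hU₁, hVU⟩ := hV ε hε
  set φ := extChartAt I p with hφ
  have hnhds : φ.target ∩ φ.symm ⁻¹' (U ∩ U₁) ∈ 𝓝 (φ p) := by
    refine inter_mem (extChartAt_target_mem_nhds p) ?_
    refine (continuousAt_extChartAt_symm p).preimage_mem_nhds ?_
    rw [extChartAt_to_inv]
    exact inter_mem hU hU₁
  obtain ⟨r, hr0, hr⟩ := Metric.nhds_basis_closedBall.mem_iff.1 hnhds
  have hC : φ.source ∩ φ ⁻¹' Metric.closedBall (φ p) r ⊆ U ∩ U₁ := by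
    rintro q ⟨hq1, hq2⟩
    have := (hr hq2).2
    rwa [mem_preimage, φ.left_inv hq1] at this
  -- Both `t` and `s k` are within this radius of `s₀`, so the distance travelled is at most `r /
  -- 4`, as `local_estimate` requires.
  refine ⟨_, isClosed_chart_closedBall (hr.trans inter_subset_left), inter_subset_left,
    hC.trans inter_subset_left, r / (8 * (‖w‖ + ε)), by positivity, fun t ht => ?_⟩
  have e1 : ∀ᶠ k in l, |s k - s₀| < r / (8 * (‖w‖ + ε)) := by
    have := hs.eventually (Metric.ball_mem_nhds s₀ (show 0 < r / (8 * (‖w‖ + ε)) by positivity))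
    simpa [Real.dist_eq] using this
  have e2 : ∀ᶠ k in l, u k (s k) ∈ φ.source :=
    hp.eventually (extChartAt_source_mem_nhds p)
  have e3 : ∀ᶠ k in l, ‖φ (u k (s k)) - φ p‖ ≤ r / 2 := by
    have := ((continuousAt_extChartAt (I := I) p).tendsto.comp hp).eventually
      (Metric.closedBall_mem_nhds _ (half_pos hr0))
    exact this.mono fun k hk => mem_closedBall_iff_norm.1 hk
  filter_upwards [e1, e2, e3, hVU] with k h1 h2 h3 h4 hk
  have hts : |t - s k| ≤ 2 * (r / (8 * (‖w‖ + ε))) := by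
    have := abs_sub_le t s₀ (s k)
    rw [abs_sub_comm s₀] at this
    linarith
  have hb : |t - s k| * (‖w‖ + ε) ≤ r / 4 := by
    calc |t - s k| * (‖w‖ + ε) ≤ 2 * (r / (8 * (‖w‖ + ε))) * (‖w‖ + ε) := by gcongr
      _ = r / 4 := by field_simp; ring
  obtain ⟨f1, f2, f3⟩ := local_estimate hr0 (hr.trans inter_subset_left) hε hb
    (fun τ hτ => (hu k τ (hk hτ)).2.continuousAt) h2 h3 (fun τ hτ g1 g2 => by
      obtain ⟨g3, g4⟩ := hu k τ (hk hτ)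
      have g5 : u k τ ∈ U ∩ U₁ := hC ⟨g1, by rwa [mem_preimage, mem_closedBall_iff_norm]⟩
      have g6 : u k τ ∈ (chartAt H p).source := by rwa [extChartAt_source] at g1
      exact ⟨_, g4.hasDerivAt_extChartAt g6, h4 _ ⟨g5.2, g3⟩⟩)
  exact ⟨⟨f1, by rwa [mem_preimage, mem_closedBall_iff_norm]⟩, f3⟩

end LocalEstimate

/-! ### Geodesics as integral curves -/

section Geodesics

variable {E : Type*} [NormedAddCommGroup E] [NormedSpace ℝ E]
  {M : Type*} [TopologicalSpace M] [ChartedSpace E M] [IsManifold 𝓘(ℝ, E) ∞ M]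
  {S : Spray E M} {c : ℝ → M} {J : Set ℝ}

/-- `w` is an integral curve of the spray `S` on the open set `J`. -/
def Spray.IsIntegralOn (S : Spray E M) (w : ℝ → TM E M) (J : Set ℝ) : Prop :=
  ∀ t ∈ J, HasVelocityAt 𝓘(ℝ, E).tangent w (S.val (w t)) t

lemma Spray.isIntegralOn_iff {w : ℝ → TM E M} (hJ : IsOpen J) :
    S.IsIntegralOn w J ↔ IsMIntegralCurveOn (I := 𝓘(ℝ, E).tangent) w S.toFun J := by
  constructor
  · exact fun h t ht => (hasVelocityAt_iff_hasMFDerivAt.1 (h t ht)).hasMFDerivWithinAt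
  · exact fun h t ht => hasVelocityAt_iff_hasMFDerivAt.2 ((h t ht).hasMFDerivAt (hJ.mem_nhds ht))

lemma Spray.IsGeodesicOn.isIntegralOn (hc : S.IsGeodesicOn c J) :
    S.IsIntegralOn (lift (E := E) c) J := (S.isIntegralOn_iff hc.1.1).2 hc.2

/-- Projectability: the base curve of an integral curve has as velocity the integral curve itself.
-/
lemma Spray.IsIntegralOn.lift_eq {w : ℝ → TM E M} (hw : S.IsIntegralOn w J) {t : ℝ}
    (ht : t ∈ J) : lift (E := E) (fun t => (w t).proj) t = w t := by
  have h1 := (hasVelocityAt_iff_hasMFDerivAt.1 (hw t ht).proj).mfderiv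
  rw [S.fst_eq] at h1
  have h2 : (mfderiv 𝓘(ℝ, ℝ) 𝓘(ℝ, E) (fun t => (w t).proj) t : ℝ →L[ℝ] E) (1 : ℝ) = fib (w t) := by
    refine (congrArg (fun L : ℝ →L[ℝ] E => L 1) h1).trans ?_
    exact one_smul ℝ (fib (w t))
  exact congrArg (mkTM (w t).proj) h2

lemma Spray.IsIntegralOn.isGeodesicOn {w : ℝ → TM E M} (hJ : IsOpenInterval J)
    (hw : S.IsIntegralOn w J) : S.IsGeodesicOn (fun t => (w t).proj) J := by
  refine ⟨hJ, (S.isIntegralOn_iff hJ.1).1 fun t ht => ?_⟩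
  rw [hw.lift_eq ht]
  refine (hw t ht).congr ?_
  filter_upwards [hJ.1.mem_nhds ht] with s hs using hw.lift_eq hs

lemma IsOpenInterval.exists_Ioo (hJ : IsOpenInterval J) {s t : ℝ} (hs : s ∈ J) (ht : t ∈ J) :
    ∃ a b, a ∈ J ∧ b ∈ J ∧ s ∈ Ioo a b ∧ t ∈ Ioo a b ∧ Ioo a b ⊆ J := by
  have key : ∀ x ∈ J, ∃ ε > 0, x - ε ∈ J ∧ x + ε ∈ J := by
    intro x hx
    obtain ⟨ε, hε, hb⟩ := Metric.isOpen_iff.1 hJ.1 x hx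
    exact ⟨ε / 2, by positivity, hb (by rw [Metric.mem_ball, Real.dist_eq]; simp [abs_of_pos, hε]),
      hb (by rw [Metric.mem_ball, Real.dist_eq]; simp [abs_of_pos, hε])⟩
  wlog hst : s ≤ t generalizing s t
  · obtain ⟨a, b, h1, h2, h3, h4, h5⟩ := this ht hs (le_of_not_ge hst)
    exact ⟨a, b, h1, h2, h4, h3, h5⟩
  obtain ⟨ε, hε, h1, -⟩ := key s hs
  obtain ⟨ε', hε', -, h2⟩ := key t ht
  exact ⟨s - ε, t + ε', h1, h2, ⟨by linarith, by linarith⟩, ⟨by linarith, by linarith⟩,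
    Ioo_subset_Icc_self.trans (hJ.2.1.out h1 h2)⟩

lemma Spray.IsIntegralOn.eqOn [FiniteDimensional ℝ E] [T2Space M] {w w' : ℝ → TM E M}
    (hJ : IsOpenInterval J) (hw : S.IsIntegralOn w J) (hw' : S.IsIntegralOn w' J) {t₀ : ℝ}
    (ht₀ : t₀ ∈ J) (h : w t₀ = w' t₀) : EqOn w w' J := by
  intro t ht
  obtain ⟨a, b, -, -, h1, h2, h3⟩ := hJ.exists_Ioo ht₀ ht
  exact isMIntegralCurveOn_Ioo_eqOn_of_contMDiff_boundaryless (I := 𝓘(ℝ, E).tangent) h1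
    (S.smooth.of_le (by simp)) (((S.isIntegralOn_iff hJ.1).1 hw).mono h3)
    (((S.isIntegralOn_iff hJ.1).1 hw').mono h3) h h2

lemma Spray.val_eq_zero {m : ℝ≥0} (hS : S.IsHomogeneous m) {v : TM E M} (hv : fib v = 0) :
    S.val v = 0 := by
  have h1 : smulTM 0 v = v := by
    conv_rhs => rw [← mkTM_fib v]
    rw [smulTM, hv, smul_zero]
  rw [← h1, S.val_smulTM hS]
  simp

/-- The spray vanishes on zero vectors, so a zero velocity at one time forces a constant geodesic by
uniqueness of integral curves. -/
lemma Spray.IsGeodesicOn.fib_ne_zero [FiniteDimensional ℝ E] [T2Space M] {m : ℝ≥0}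
    (hS : S.IsHomogeneous m) (hc : S.IsGeodesicOn c J) {s t : ℝ} (hs : s ∈ J) (ht : t ∈ J)
    (hst : c s ≠ c t) : ∀ r ∈ J, fib (lift (E := E) c r) ≠ 0 := by
  intro r hr h0
  have h1 : S.IsIntegralOn (fun _ => lift (E := E) c r) J := fun x _ => by
    rw [S.val_eq_zero hS h0]
    exact hasVelocityAt_const _ _
  have h2 := hc.isIntegralOn.eqOn hc.1 h1 hr rfl
  have h3 : (lift (E := E) c s).proj = (lift (E := E) c t).proj := by rw [h2 hs, h2 ht]
  exact hst h3

lemma IsOpenInterval.neg (hJ : IsOpenInterval J) : IsOpenInterval {t | -t ∈ J} := by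
  refine ⟨hJ.1.preimage continuous_neg, ?_, ?_⟩
  · refine ⟨fun x hx y hy z hz => hJ.2.1.out hy hx ⟨?_, ?_⟩⟩
    · linarith [hz.2]
    · linarith [hz.1]
  · obtain ⟨t, ht⟩ := hJ.2.2
    exact ⟨-t, by simpa using ht⟩

lemma Spray.IsGeodesicOn.neg {m : ℝ≥0} (hS : S.IsHomogeneous m) (hc : S.IsGeodesicOn c J) :
    S.IsGeodesicOn (fun t => c (-t)) {t | -t ∈ J} := by
  have h1 : S.IsIntegralOn (fun t => smulTM (-1) (lift (E := E) c (-t))) {t | -t ∈ J} := by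
    intro t ht
    have h2 := hasVelocityAt_smul (σ := fun t => -t) (l := fun _ => (-1 : ℝ))
      (hc.isIntegralOn (-t) ht) (hasDerivAt_neg t) (hasDerivAt_const t _)
    convert! h2 using 1
    rw [S.val_smulTM hS, S.fst_eq]
    simp
  exact h1.isGeodesicOn hc.1.neg

lemma Spray.IsInextendible.neg {m : ℝ≥0} (hS : S.IsHomogeneous m) (hc : S.IsInextendible c J) :
    S.IsInextendible (fun t => c (-t)) {t | -t ∈ J} := by
  refine ⟨hc.1.neg hS, fun c' J' hc' hJ' heq => ?_⟩
  have h1 := hc.2 _ _ (hc'.neg hS) (fun t ht => hJ' (by simpa using ht)) (fun t ht => by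
    have := heq (show -t ∈ {t | -t ∈ J} by simpa using ht)
    simpa using this)
  ext t
  rw [← h1]
  simp

lemma Spray.exists_nhds_norm_sub_lt (S : Spray E M) (p : TM E M) {ε : ℝ} (hε : 0 < ε) :
    ∃ U ∈ 𝓝 p, ∀ q ∈ U, ‖(trivializationAt (E × E) (TangentSpace 𝓘(ℝ, E).tangent) p
      (mkTTM q (S.val q))).2 - S.val p‖ < ε := by
  have h1 := (S.contMDiffAt_trivializationAt p).continuousAt
  have h2 := h1.tendsto.eventually (Metric.ball_mem_nhds _ hε)
  rw [trivializationAt_mkTTM rfl] at h2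
  exact ⟨_, h2, fun q hq => mem_ball_iff_norm.1 hq⟩

/-- An integral curve of a spray that stays in a compact set extends. -/
lemma Spray.IsIntegralOn.exists_extension [FiniteDimensional ℝ E] [T2Space M] {γ : ℝ → TM E M}
    (hJ : IsOpenInterval J) (hγ : S.IsIntegralOn γ J) {t₀ b : ℝ} (ht₀ : t₀ < b) (hb : b ∉ J)
    (hJb : Ico t₀ b ⊆ J) {Q : Set (TM E M)} (hQ : IsCompact Q) (hγQ : ∀ t ∈ Ico t₀ b, γ t ∈ Q) :
    ∃ (w : ℝ → TM E M) (J' : Set ℝ), IsOpenInterval J' ∧ J ⊆ J' ∧ b ∈ J' ∧ EqOn w γ J ∧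
      S.IsIntegralOn w J' := by
  have hlt : ∀ t ∈ J, t < b := fun t ht => by
    by_contra hbt
    exact hb (hJ.2.1.out (hJb ⟨le_rfl, ht₀⟩) ht ⟨ht₀.le, not_lt.1 hbt⟩)
  -- Compactness gives a limit `p` only along this ultrafilter; the estimate `hleft` upgrades it to
  -- a full left limit with slope `S.val p`.
  set f := Ultrafilter.of (𝓝[<] b)
  have hf : (f : Filter ℝ) ≤ 𝓝[<] b := Ultrafilter.of_le _
  have hfI : ∀ᶠ k in (f : Filter ℝ), k ∈ Ico t₀ b := hf (Ico_mem_nhdsLT ht₀)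
  obtain ⟨p, -, hp⟩ := isCompact_iff_ultrafilter_le_nhds.1 hQ (f.map γ)
    (le_principal_iff.2 (hfI.mono hγQ))
  have hp' : Tendsto γ (f : Filter ℝ) (𝓝 p) := hp
  have hfb : Tendsto id (f : Filter ℝ) (𝓝 b) := hf.trans nhdsWithin_le_nhds
  have hleft : ∀ ε > 0, ∃ δ > 0, ∀ t ∈ J, |t - b| < δ →
      γ t ∈ (extChartAt 𝓘(ℝ, E).tangent p).source ∧
      ‖extChartAt 𝓘(ℝ, E).tangent p (γ t) - extChartAt 𝓘(ℝ, E).tangent p p -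
        (t - b) • S.val p‖ ≤ ε * |t - b| := by
    intro ε hε
    -- The family is constant and the index is the starting time `k`, which then tends to `b`.
    obtain ⟨C, -, hC, -, δ, hδ, hest⟩ := limit_estimate (I := 𝓘(ℝ, E).tangent)
      (l := (f : Filter ℝ)) (u := fun _ => γ) (V := fun _ => S.val) (D := fun _ => J) (Q := univ)
      (fun _ t ht => ⟨mem_univ _, hγ t ht⟩) (p := p) (w := S.val p)
      (fun ε hε => by
        obtain ⟨U, hU, hUe⟩ := S.exists_nhds_norm_sub_lt p hε
        exact ⟨U, hU, Eventually.of_forall fun _ q hq => hUe q hq.1⟩) hfb hp' hε univ_mem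
    refine ⟨δ, hδ, fun t ht htb => ?_⟩
    have h1 : ∀ᶠ k in (f : Filter ℝ), γ t ∈ C ∧
        ‖extChartAt 𝓘(ℝ, E).tangent p (γ t) - extChartAt 𝓘(ℝ, E).tangent p (γ k) -
          (t - k) • S.val p‖ ≤ ε * |t - k| := by
      filter_upwards [hest t htb, hfI] with k h1 h2
      exact h1 (hJ.2.1.uIcc_subset (hJb h2) ht)
    obtain ⟨k, hk⟩ := h1.exists
    refine ⟨hC hk.1, ?_⟩
    have h2 : Tendsto (fun k => extChartAt 𝓘(ℝ, E).tangent p (γ k)) (f : Filter ℝ)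
        (𝓝 (extChartAt 𝓘(ℝ, E).tangent p p)) :=
      (continuousAt_extChartAt (I := 𝓘(ℝ, E).tangent) p).tendsto.comp hp'
    have h3 : Tendsto (fun k : ℝ => t - k) (f : Filter ℝ) (𝓝 (t - b)) :=
      tendsto_const_nhds.sub hfb
    exact le_of_tendsto_of_tendsto ((tendsto_const_nhds.sub h2).sub (h3.smul_const _)).norm
      (h3.abs.const_mul ε) (h1.mono fun k hk => hk.2)
  obtain ⟨D, hDb, hD⟩ := exists_isMIntegralCurveAt_of_contMDiffAt_boundaryless
    (I := 𝓘(ℝ, E).tangent) (v := S.toFun) b ((S.smooth.of_le (by simp)) p : ContMDiffAt _ _ 1 _ p)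
  obtain ⟨ε₁, hε₁, hD'⟩ := isMIntegralCurveAt_iff'.1 hD
  have hDv : S.IsIntegralOn D (Metric.ball b ε₁) := (S.isIntegralOn_iff Metric.isOpen_ball).2 hD'
  rw [Real.ball_eq_Ioo] at hDv
  -- The continuation is glued to the integral curve through `p`; the two one-sided slopes agree at
  -- `b`.
  set w : ℝ → TM E M := fun t => if t < b then γ t else D t with hw
  have hwl : ∀ t, t < b → w t = γ t := fun t ht => if_pos ht
  have hwr : ∀ t, b ≤ t → w t = D t := fun t ht => if_neg (not_lt.2 ht)
  have hwb : w b = p := (hwr b le_rfl).trans hDb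
  refine ⟨w, J ∪ Ioo t₀ (b + ε₁), ⟨hJ.1.union isOpen_Ioo, ?_, hJ.2.2.mono subset_union_left⟩,
    subset_union_left, Or.inr ⟨ht₀, by linarith⟩, fun t ht => hwl t (hlt t ht), ?_⟩
  · have h1 : (t₀ + b) / 2 ∈ J := hJb ⟨by linarith, by linarith⟩
    have h2 : (t₀ + b) / 2 ∈ Ioo t₀ (b + ε₁) := ⟨by linarith, by linarith⟩
    exact (IsPreconnected.union _ h1 h2 hJ.2.1.isPreconnected isPreconnected_Ioo).ordConnected
  intro t ht
  rcases lt_trichotomy t b with htb | rfl | htb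
  · have htJ : t ∈ J := ht.elim id fun h => hJb ⟨h.1.le, htb⟩
    rw [hwl t htb]
    refine (hγ t htJ).congr ?_
    filter_upwards [Iio_mem_nhds htb] with s hs using hwl s hs
  · refine hasVelocityAt_of_eventually_le fun ε hε => ?_
    rw [hwb]
    obtain ⟨δ, hδ, hδe⟩ := hleft ε hε
    have hDt := hDv t ⟨by linarith, by linarith⟩
    have h1 := hDt.2
    rw [hDb, hasDerivAt_iff_isLittleO, Asymptotics.isLittleO_iff] at h1
    have h2 : ∀ᶠ s in 𝓝 t, D s ∈ (extChartAt 𝓘(ℝ, E).tangent p).source := by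
      refine hDt.1.eventually_mem ?_
      rw [hDb]
      exact extChartAt_source_mem_nhds p
    have h3 : ∀ᶠ s in 𝓝 t, |s - t| < δ := by
      have := Metric.ball_mem_nhds t hδ
      filter_upwards [this] with s hs using by simpa [Real.dist_eq] using hs
    filter_upwards [h1 hε, h2, h3, Ioi_mem_nhds ht₀] with s e1 e2 e3 e4
    rcases lt_or_ge s t with hs | hs
    · rw [hwl s hs]
      exact hδe s (hJb ⟨le_of_lt e4, hs⟩) e3
    · rw [hwr s hs]
      rw [hDb] at e1
      exact ⟨e2, e1⟩
  · have htJ : t ∈ Ioo (b - ε₁) (b + ε₁) := by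
      rcases ht with h | h
      · exact absurd (hlt t h) (not_lt.2 htb.le)
      · exact ⟨by linarith, h.2⟩
    rw [hwr t htb.le]
    refine (hDv t htJ).congr ?_
    filter_upwards [Ioi_mem_nhds htb] with s hs using hwr s (le_of_lt hs)

end Geodesics

/-! ### Geodesics parametrized by arc length -/

section UnitCurves

variable {E : Type*} [NormedAddCommGroup E] [NormedSpace ℝ E]
  {M : Type*} [TopologicalSpace M] [ChartedSpace E M] [IsManifold 𝓘(ℝ, E) ∞ M]
  {S : Spray E M} {h : RMetric E M} {c : ℝ → M} {J : Set ℝ}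

/-- Half the derivative of the squared length along the spray. -/
def Spray.accel (S : Spray E M) (h : RMetric E M) (v : TM E M) : ℝ :=
  2⁻¹ * dNormSq h v (S.val v)

/-- The vector field on the unit bundle whose integral curves are the geodesics, parametrized by
arc length. -/
def Spray.unitField (S : Spray E M) (h : RMetric E M) (v : TM E M) : E × E :=
  S.val v - S.accel h v • ((0 : E), fib v)

lemma Spray.continuous_accel (S : Spray E M) (h : RMetric E M) : Continuous (S.accel h) :=
  continuous_const.mul ((continuous_dNormSq h).comp S.contMDiff.continuous)

/-- `u` is a geodesic of `S` parametrized by `h`-arc length, on `J`. -/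
def Spray.IsUnitCurve (S : Spray E M) (h : RMetric E M) (u : ℝ → TM E M) (J : Set ℝ) : Prop :=
  ∀ s ∈ J, normSq h (u s) = 1 ∧ HasVelocityAt 𝓘(ℝ, E).tangent u (S.unitField h (u s)) s

/-- Differentiating the constant squared length determines the coefficient of the Euler field, so
reparametrized curves need no explicit computation of it. -/
lemma coeff_eq_neg_accel {u : ℝ → TM E M} {s k : ℝ} (hu : ∀ᶠ r in 𝓝 s, normSq h (u r) = 1)
    (hv : HasVelocityAt 𝓘(ℝ, E).tangent u (S.val (u s) + k • ((0 : E), fib (u s))) s) :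
    k = - S.accel h (u s) := by
  have h1 := hv.hasDerivAt_normSq h
  have h2 : HasDerivAt (fun r => normSq h (u r)) 0 s :=
    (hasDerivAt_const s (1 : ℝ)).congr_of_eventuallyEq hu
  have h3 := h1.unique h2
  rw [map_add, map_smul, dNormSq_vertical, hu.self_of_nhds] at h3
  rw [Spray.accel]
  simp only [smul_eq_mul] at h3
  linarith

/-- The parametrization of a geodesic by arc length. -/
lemma Spray.IsGeodesicOn.exists_unitCurve {m : ℝ≥0} (hS : S.IsHomogeneous m)
    (hc : S.IsGeodesicOn c J) (h : RMetric E M) (hfib : ∀ t ∈ J, fib (lift (E := E) c t) ≠ 0)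
    {t₀ : ℝ} (ht₀ : t₀ ∈ J) :
    ∃ (l ρ : ℝ → ℝ) (u : ℝ → TM E M), l t₀ = 0 ∧ StrictMonoOn l J ∧ IsOpenInterval (l '' J) ∧
      S.IsUnitCurve h u (l '' J) ∧ (∀ t ∈ J, 0 < ρ t) ∧
      (∀ t ∈ J, lift (E := E) c t = smulTM (ρ t) (u (l t))) ∧
      (∀ t ∈ J, HasDerivAt l (ρ t) t) ∧
      (∀ t ∈ J, HasDerivAt (fun t => (ρ t)⁻¹) (- S.accel h (u (l t))) t) := by
  have hJ := hc.1
  set γ := lift (E := E) c with hγ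
  have hγv := hc.isIntegralOn
  have hN : ∀ t ∈ J, 0 < normSq h (γ t) := fun t ht => normSq_pos h (hfib t ht)
  set ρ : ℝ → ℝ := fun t => √(normSq h (γ t)) with hρ
  have hρpos : ∀ t ∈ J, 0 < ρ t := fun t ht => Real.sqrt_pos.2 (hN t ht)
  have hρd : ∀ t ∈ J, ∃ ρ', HasDerivAt ρ ρ' t := fun t ht =>
    ⟨_, ((hγv t ht).hasDerivAt_normSq h).sqrt (hN t ht).ne'⟩
  have hρc : ContinuousOn ρ J := fun t ht =>
    (hρd t ht).choose_spec.continuousAt.continuousWithinAt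
  obtain ⟨l, hl0, hl⟩ := exists_primitive hJ hρc ht₀
  obtain ⟨hmono, hint, σ, hσl, hσ⟩ := exists_hasDerivAt_inverse hJ hl hρpos
  set u : ℝ → TM E M := fun s => smulTM (ρ (σ s))⁻¹ (γ (σ s)) with hu
  have hul : ∀ t ∈ J, u (l t) = smulTM (ρ t)⁻¹ (γ t) := fun t ht => by
    simp only [hu]
    rw [hσl t ht]
  have hunit : ∀ s ∈ l '' J, normSq h (u s) = 1 := by
    rintro _ ⟨t, ht, rfl⟩
    rw [hul t ht, normSq_smulTM, inv_pow, hρ]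
    simp only
    rw [Real.sq_sqrt (hN t ht).le, inv_mul_cancel₀ (hN t ht).ne']
  have hvel : ∀ t ∈ J, ∃ k, HasDerivAt (fun t => (ρ t)⁻¹) k t ∧
      HasVelocityAt 𝓘(ℝ, E).tangent u (S.val (u (l t)) + k • ((0 : E), fib (u (l t)))) (l t) := by
    intro t ht
    obtain ⟨ρ', hρ'⟩ := hρd t ht
    have hinv := hρ'.inv (hρpos t ht).ne'
    refine ⟨_, hinv, ?_⟩
    have hσt := hσl t ht
    have h1 : HasDerivAt (fun s => (ρ (σ s))⁻¹) (-ρ' / ρ t ^ 2 * (ρ t)⁻¹) (l t) := by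
      refine HasDerivAt.comp (l t) (h₂ := fun t => (ρ t)⁻¹) ?_ (hσ t ht)
      rw [hσt]
      exact hinv
    have h2 := hasVelocityAt_smul (σ := σ) (l := fun s => (ρ (σ s))⁻¹) (s := l t)
      (w := S.val (γ t)) (γ := γ) (by rw [hσt]; exact hγv t ht) (hσ t ht) h1
    convert! h2 using 1
    rw [hul t ht, S.val_smulTM hS, hσt, S.fst_eq]
    refine Prod.ext ?_ ?_
    · simp
    · simp only [Prod.snd_add, Prod.smul_snd, fib_smulTM, smul_smul]
      ring_nf
  refine ⟨l, ρ, u, hl0, hmono, hint, ?_, hρpos, ?_, hl, ?_⟩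
  · rintro _ ⟨t, ht, rfl⟩
    refine ⟨hunit _ ⟨t, ht, rfl⟩, ?_⟩
    obtain ⟨k, -, hk⟩ := hvel t ht
    have h1 := coeff_eq_neg_accel (h := h)
      (by filter_upwards [hint.1.mem_nhds ⟨t, ht, rfl⟩] with s hs using hunit s hs) hk
    rw [h1, neg_smul, ← sub_eq_add_neg] at hk
    exact hk
  · intro t ht
    rw [hul t ht, smulTM_smulTM, mul_inv_cancel₀ (hρpos t ht).ne', smulTM_one]
  · intro t ht
    obtain ⟨k, hk1, hk⟩ := hvel t ht
    have h1 := coeff_eq_neg_accel (h := h)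
      (by filter_upwards [hint.1.mem_nhds ⟨t, ht, rfl⟩] with s hs using hunit s hs) hk
    rwa [h1] at hk1

lemma continuous_smulTM : Continuous (fun x : ℝ × TM E M => smulTM x.1 x.2) := by
  rw [continuous_iff_continuousAt]
  rintro ⟨c, v⟩
  have hp : ContinuousAt (fun x : ℝ × TM E M => x.2.proj) (c, v) :=
    ((FiberBundle.continuous_proj E (TangentSpace 𝓘(ℝ, E))).comp continuous_snd).continuousAt
  refine (FiberBundle.continuousAt_totalSpace E
    (f := fun x : ℝ × TM E M => smulTM x.1 x.2) (x₀ := (c, v))).2 ⟨hp, ?_⟩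
  have h0 : ContinuousAt (fun w : TM E M =>
      (trivializationAt E (TangentSpace 𝓘(ℝ, E)) v.proj w).2) v :=
    ((FiberBundle.continuousAt_totalSpace E (f := fun w : TM E M => w)
      (x₀ := v)).1 continuousAt_id).2
  have h1 : ContinuousAt (fun x : ℝ × TM E M =>
      (trivializationAt E (TangentSpace 𝓘(ℝ, E)) v.proj x.2).2) (c, v) :=
    ContinuousAt.comp_of_eq (g := fun w : TM E M =>
      (trivializationAt E (TangentSpace 𝓘(ℝ, E)) v.proj w).2) h0 continuousAt_snd rfl
  have h2 : ContinuousAt (fun x : ℝ × TM E M => x.1 •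
      (trivializationAt E (TangentSpace 𝓘(ℝ, E)) v.proj x.2).2) (c, v) := continuousAt_fst.smul h1
  have h3 : (fun x : ℝ × TM E M => x.1 •
      (trivializationAt E (TangentSpace 𝓘(ℝ, E)) v.proj x.2).2) =ᶠ[𝓝 (c, v)] fun x =>
      (trivializationAt E (TangentSpace 𝓘(ℝ, E)) v.proj (smulTM x.1 x.2)).2 := by
    filter_upwards [hp.eventually_mem
      ((chartAt E v.proj).open_source.mem_nhds (mem_chart_source _ _))] with x hx
    exact (trivializationAt_smul _ _ hx _).symm
  exact h2.congr h3

/-- An inextendible geodesic that stays in a compact set has infinite length. -/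
lemma exists_lt_length_of_inextendible [FiniteDimensional ℝ E] [T2Space M]
    (hc : S.IsInextendible c J) {t₀ : ℝ} (ht₀ : t₀ ∈ J) {l ρ : ℝ → ℝ} {u : ℝ → TM E M}
    (hl0 : l t₀ = 0) (hu : S.IsUnitCurve h u (l '' J))
    (hρ : ∀ t ∈ J, 0 < ρ t) (hlift : ∀ t ∈ J, lift (E := E) c t = smulTM (ρ t) (u (l t)))
    (hl : ∀ t ∈ J, HasDerivAt l (ρ t) t)
    (hr : ∀ t ∈ J, HasDerivAt (fun t => (ρ t)⁻¹) (- S.accel h (u (l t))) t)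
    {A : Set M} (hA : IsCompact A) (hcA : ∀ t ∈ J, t₀ ≤ t → c t ∈ A) (L : ℝ) :
    ∃ t ∈ J, t₀ ≤ t ∧ L < l t := by
  by_contra! hcon
  have hJ := hc.1.1
  have hL : 0 ≤ L := by simpa [hl0] using hcon t₀ ht₀ le_rfl
  have huA : ∀ t ∈ J, t₀ ≤ t → u (l t) ∈ unitOver h A := fun t ht htt => by
    refine ⟨?_, (hu _ ⟨t, ht, rfl⟩).1⟩
    have h1 : (lift (E := E) c t).proj = (u (l t)).proj := by rw [hlift t ht, smulTM_proj]
    rw [← h1]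
    exact hcA t ht htt
  obtain ⟨K, hK⟩ := (isCompact_unitOver h hA).exists_bound_of_continuousOn
    (S.continuous_accel h).continuousOn
  have hK0 : 0 ≤ K := (norm_nonneg _).trans (hK _ (huA t₀ ht₀ le_rfl))
  have hsub : ∀ t ∈ J, t₀ ≤ t → Icc t₀ t ⊆ J := fun t ht _ => hJ.2.1.out ht₀ ht
  -- the logarithm of the speed is controlled by the length
  have hlog : ∀ t ∈ J, HasDerivAt (fun t => Real.log (ρ t)⁻¹)
      (- S.accel h (u (l t)) * ρ t) t := fun t ht => by
    have := (hr t ht).log (inv_pos.2 (hρ t ht)).ne'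
    simpa [div_eq_mul_inv] using this
  have hbound : ∀ t ∈ J, t₀ ≤ t → |Real.log (ρ t)⁻¹ - Real.log (ρ t₀)⁻¹| ≤ K * L := by
    intro t ht htt
    have hcv : Convex ℝ (Icc t₀ t) := convex_Icc _ _
    have hacc : ∀ s ∈ Icc t₀ t, |S.accel h (u (l s))| ≤ K := fun s hs =>
      hK _ (huA s (hsub t ht htt hs) hs.1)
    -- The sign `σ` treats both bounds at once: the logarithm of the speed changes by at most `K`
    -- per unit of length.
    have key : ∀ σ : ℝ, |σ| ≤ 1 → σ * (Real.log (ρ t)⁻¹ - Real.log (ρ t₀)⁻¹) ≤ K * L := by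
      intro σ hσ
      have hd : ∀ s ∈ Icc t₀ t, HasDerivAt (fun s => K * l s - σ * Real.log (ρ s)⁻¹)
          (K * ρ s - σ * (- S.accel h (u (l s)) * ρ s)) s := fun s hs =>
        ((hl s (hsub t ht htt hs)).const_mul K).sub ((hlog s (hsub t ht htt hs)).const_mul σ)
      have hm : MonotoneOn (fun s => K * l s - σ * Real.log (ρ s)⁻¹) (Icc t₀ t) := by
        refine monotoneOn_of_deriv_nonneg hcv
          (fun s hs => (hd s hs).continuousAt.continuousWithinAt)
          (fun s hs => (hd s (interior_subset hs)).differentiableAt.differentiableWithinAt)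
          fun s hs => ?_
        rw [(hd s (interior_subset hs)).deriv]
        have e1 := hacc s (interior_subset hs)
        have e2 := hρ s (hsub t ht htt (interior_subset hs))
        have e3 : |σ * S.accel h (u (l s))| ≤ K := by
          rw [abs_mul]
          calc _ ≤ 1 * K := by gcongr
            _ = K := one_mul K
        have e4 := neg_abs_le (σ * S.accel h (u (l s)))
        have e5 : 0 ≤ (K + σ * S.accel h (u (l s))) * ρ s :=
          mul_nonneg (by linarith) e2.le
        linarith
      have h1 := hm ⟨le_rfl, htt⟩ ⟨htt, le_rfl⟩ htt
      simp only [hl0] at h1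
      have h2 : K * l t ≤ K * L := by
        gcongr
        exact hcon t ht htt
      linarith
    rw [abs_le]
    constructor
    · have := key (-1) (by simp)
      linarith
    · have := key 1 (by simp)
      linarith
  set a := Real.log (ρ t₀)⁻¹ with ha
  have hρlo : ∀ t ∈ J, t₀ ≤ t → Real.exp (-(a + K * L)) ≤ ρ t := fun t ht htt => by
    have h1 := (abs_le.1 (hbound t ht htt)).2
    rw [Real.log_inv] at h1
    rw [← Real.exp_log (hρ t ht)]
    exact Real.exp_le_exp.2 (by linarith)
  have hρhi : ∀ t ∈ J, t₀ ≤ t → ρ t ≤ Real.exp (K * L - a) := fun t ht htt => by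
    have h1 := (abs_le.1 (hbound t ht htt)).1
    rw [Real.log_inv] at h1
    rw [← Real.exp_log (hρ t ht)]
    exact Real.exp_le_exp.2 (by linarith)
  set d := Real.exp (-(a + K * L)) with hd
  have hd0 : 0 < d := Real.exp_pos _
  -- Speed at least `d` and length at most `L` allow only a time `L / d` after `t₀`.
  have hJb : ∀ t ∈ J, t ≤ t₀ + L / d := by
    intro t ht
    rcases le_total t t₀ with htt | htt
    · have : 0 ≤ L / d := by positivity
      linarith
    have hm : MonotoneOn (fun s => l s - d * s) (Icc t₀ t) := by
      have hd' : ∀ s ∈ Icc t₀ t, HasDerivAt (fun s => l s - d * s) (ρ s - d * 1) s := fun s hs =>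
        (hl s (hsub t ht htt hs)).sub ((hasDerivAt_id s).const_mul d)
      refine monotoneOn_of_deriv_nonneg (convex_Icc _ _)
        (fun s hs => (hd' s hs).continuousAt.continuousWithinAt)
        (fun s hs => (hd' s (interior_subset hs)).differentiableAt.differentiableWithinAt)
        fun s hs => ?_
      have hs' := interior_subset hs
      rw [(hd' s hs').deriv]
      have := hρlo s (hsub t ht htt hs') hs'.1
      linarith
    have h1 := hm ⟨le_rfl, htt⟩ ⟨htt, le_rfl⟩ htt
    simp only [hl0] at h1
    have h2 := hcon t ht htt
    have h3 : (t - t₀) * d ≤ L := by linarith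
    have h4 := (le_div_iff₀ hd0).2 h3
    linarith
  -- so the domain has a finite end point, and the geodesic extends beyond it
  have hbdd : BddAbove J := ⟨_, hJb⟩
  set b := sSup J with hb
  have hbJ : b ∉ J := fun hbJ => by
    obtain ⟨x, y, -, hy, h1, -, -⟩ := hJ.exists_Ioo hbJ hbJ
    exact absurd (le_csSup hbdd hy) (not_le.2 h1.2)
  have ht₀b : t₀ < b := lt_of_le_of_ne (le_csSup hbdd ht₀) fun e => hbJ (e ▸ ht₀)
  have hIco : Ico t₀ b ⊆ J := fun t ht => by
    obtain ⟨s, hs, hts⟩ := exists_lt_of_lt_csSup hJ.2.2 ht.2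
    exact hJ.2.1.out ht₀ hs ⟨ht.1, hts.le⟩
  have hQ : IsCompact ((fun x : ℝ × TM E M => smulTM x.1 x.2) ''
      (Icc d (Real.exp (K * L - a)) ×ˢ unitOver h A)) :=
    (isCompact_Icc.prod (isCompact_unitOver h hA)).image continuous_smulTM
  obtain ⟨w, J', hJ', hJJ', hbJ', hwc, hw⟩ := hc.1.isIntegralOn.exists_extension hJ ht₀b hbJ hIco hQ
    fun t ht => by
      have htJ := hIco ht
      rw [hlift t htJ]
      exact ⟨(ρ t, u (l t)), ⟨⟨hρlo t htJ ht.1, hρhi t htJ ht.1⟩, huA t htJ ht.1⟩, rfl⟩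
  have h1 := hc.2 _ J' (hw.isGeodesicOn hJ') hJJ' fun t ht => by
    have := hwc ht
    simp only [this]
    rfl
  rw [h1] at hbJ'
  exact hbJ hbJ'

/-- The affine parametrization of a curve parametrized by arc length. -/
lemma Spray.IsUnitCurve.exists_geodesic {m : ℝ≥0} (hS : S.IsHomogeneous m) {u : ℝ → TM E M}
    (hJ : IsOpenInterval J) (hu : S.IsUnitCurve h u J) :
    ∃ (τ θ : ℝ → ℝ) (w : ℝ → TM E M), StrictMonoOn τ J ∧ IsOpenInterval (τ '' J) ∧
      S.IsIntegralOn w (τ '' J) ∧ (∀ s ∈ J, 0 < θ s) ∧ (∀ s ∈ J, HasDerivAt τ (θ s) s) ∧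
      ∀ s ∈ J, w (τ s) = smulTM (θ s)⁻¹ (u s) := by
  obtain ⟨s₀, hs₀⟩ := hJ.2.2
  have hac : ContinuousOn (fun s => S.accel h (u s)) J := fun s hs =>
    ((S.continuous_accel h).continuousAt.comp (hu s hs).2.continuousAt).continuousWithinAt
  obtain ⟨G, -, hG⟩ := exists_primitive hJ hac hs₀
  -- The factor for which the derivative of `1 / θ` cancels the Euler term of the unit field.
  set θ : ℝ → ℝ := fun s => Real.exp (-G s) with hθ
  have hθd : ∀ s ∈ J, HasDerivAt (fun s => (θ s)⁻¹) ((θ s)⁻¹ * S.accel h (u s)) s := by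
    intro s hs
    have := (hG s hs).exp
    simpa [hθ, Real.exp_neg] using this
  have hθc : ContinuousOn θ J := fun s hs =>
    (hG s hs).neg.exp.continuousAt.continuousWithinAt
  have hθpos : ∀ s ∈ J, 0 < θ s := fun s _ => Real.exp_pos _
  obtain ⟨τ, -, hτ⟩ := exists_primitive hJ hθc hs₀
  obtain ⟨hmono, hint, σ, hστ, hσ⟩ := exists_hasDerivAt_inverse hJ hτ hθpos
  have hw : ∀ s ∈ J, smulTM (θ (σ (τ s)))⁻¹ (u (σ (τ s))) = smulTM (θ s)⁻¹ (u s) := fun s hs => by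
    rw [hστ s hs]
  refine ⟨τ, θ, fun t => smulTM (θ (σ t))⁻¹ (u (σ t)), hmono, hint, ?_, hθpos, hτ, hw⟩
  rintro _ ⟨s, hs, rfl⟩
  have hs' := hστ s hs
  have h1 : HasDerivAt (fun t => (θ (σ t))⁻¹) ((θ s)⁻¹ * S.accel h (u s) * (θ s)⁻¹) (τ s) := by
    refine HasDerivAt.comp (τ s) (h₂ := fun s => (θ s)⁻¹) ?_ (hσ s hs)
    rw [hs']
    exact hθd s hs
  have h2 := hasVelocityAt_smul (σ := σ) (l := fun t => (θ (σ t))⁻¹) (s := τ s)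
    (w := S.unitField h (u s)) (γ := u) (by rw [hs']; exact (hu s hs).2) (hσ s hs) h1
  convert! h2 using 1
  beta_reduce
  rw [hw s hs, S.val_smulTM hS, hs', Spray.unitField]
  refine Prod.ext ?_ ?_
  · simp [S.fst_eq]
  · simp only [Prod.snd_sub, Prod.smul_snd]
    module

end UnitCurves

/-! ### Limits of geodesics of converging sprays -/

section Limits

variable {E : Type*} [NormedAddCommGroup E] [NormedSpace ℝ E]
  {M : Type*} [TopologicalSpace M] [ChartedSpace E M] [IsManifold 𝓘(ℝ, E) ∞ M]
  {S : Spray E M} {h : RMetric E M} {m : ℝ≥0}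

lemma Spray.IsUnitCurve.mono {u : ℝ → TM E M} {J J' : Set ℝ} (hu : S.IsUnitCurve h u J)
    (hJ : J' ⊆ J) : S.IsUnitCurve h u J' := fun s hs => hu s (hJ hs)

lemma Spray.IsUnitCurve.comp_add {u : ℝ → TM E M} {J : Set ℝ} (hu : S.IsUnitCurve h u J) (a : ℝ) :
    S.IsUnitCurve h (fun s => u (s + a)) {s | s + a ∈ J} := fun s hs => by
  refine ⟨(hu _ hs).1, ?_⟩
  have := (hu _ hs).2.comp (σ := fun s => s + a) ((hasDerivAt_id s).add_const a)
  rwa [one_smul] at this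

lemma Spray.IsUnitCurve.neg (hS : S.IsHomogeneous m) {u : ℝ → TM E M} {J : Set ℝ}
    (hJ : IsOpen J) (hu : S.IsUnitCurve h u J) :
    S.IsUnitCurve h (fun s => smulTM (-1) (u (-s))) {s | -s ∈ J} := by
  have hunit : ∀ s ∈ {s | -s ∈ J}, normSq h (smulTM (-1) (u (-s))) = 1 := fun s hs => by
    rw [normSq_smulTM, (hu _ hs).1]
    norm_num
  refine fun s hs => ⟨hunit s hs, ?_⟩
  have h2 := hasVelocityAt_smul (σ := fun t => -t) (l := fun _ => (-1 : ℝ))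
      (hu (-s) hs).2 (hasDerivAt_neg s) (hasDerivAt_const s _)
  have h3 : ((-1 : ℝ) • (S.unitField h (u (-s))).1,
      (-1 * -1 : ℝ) • (S.unitField h (u (-s))).2 + (0 : ℝ) • fib (u (-s))) =
      S.val (smulTM (-1) (u (-s))) +
        S.accel h (u (-s)) • ((0 : E), fib (smulTM (-1) (u (-s)))) := by
    rw [S.val_smulTM hS, Spray.unitField]
    refine Prod.ext ?_ ?_
    · simp [S.fst_eq]
    · simp only [Prod.snd_sub, Prod.snd_add, Prod.smul_snd, fib_smulTM]
      module
  rw [h3] at h2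
  have h4 := coeff_eq_neg_accel (h := h) (u := fun s => smulTM (-1) (u (-s))) (s := s)
    (by filter_upwards [(hJ.preimage continuous_neg).mem_nhds hs] with r hr using hunit r hr) h2
  rw [h4, neg_smul, ← sub_eq_add_neg] at h2
  exact h2

/-- The sprays `Sk k` converge to `S` along `l`, uniformly on `Q`. -/
def SprayTendsto {ι : Type*} (l : Filter ι) (Sk : ι → Spray E M) (S : Spray E M)
    (Q : Set (TM E M)) : Prop :=
  ∀ W : Set (TTM E M), IsOpen W → (∀ v ∈ Q, mkTTM v (S.val v) ∈ W) →
    ∀ᶠ k in l, ∀ v ∈ Q, mkTTM v ((Sk k).val v) ∈ W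

/-- The unit field at `q` is, in the trivialization at `p`, a function `T` of the point `S q` of
`TTM` that is continuous at `S p`. Convergence of the sprays as subsets of `TTM` therefore passes to
the unit fields, uniformly near `p`. -/
lemma SprayTendsto.unitField [FiniteDimensional ℝ E] [T2Space M] {ι : Type*} {l : Filter ι}
    {Sk : ι → Spray E M} {Q : Set (TM E M)} (hl : SprayTendsto l Sk S Q) (h : RMetric E M)
    (p : TM E M) {ε : ℝ} (hε : 0 < ε) :
    ∃ U ∈ 𝓝 p, ∀ᶠ k in l, ∀ q ∈ U ∩ Q,
      ‖(trivializationAt (E × E) (TangentSpace 𝓘(ℝ, E).tangent) p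
        (mkTTM q ((Sk k).unitField h q))).2 - S.unitField h p‖ < ε := by
  have : LocallyCompactSpace (TM E M) :=
    Manifold.locallyCompact_of_finiteDimensional 𝓘(ℝ, E).tangent
  set ξ₀ : TTM E M := mkTTM p (S.val p) with hξ₀
  set T : TTM E M → E × E := fun ξ =>
    (trivializationAt (E × E) (TangentSpace 𝓘(ℝ, E).tangent) p ξ).2 -
      (2⁻¹ * dNormSq h ξ.proj ξ.snd) •
        ((0 : E), (trivializationAt E (TangentSpace 𝓘(ℝ, E)) p.proj ξ.proj).2) with hT
  have hTval : ∀ (S' : Spray E M) (q : TM E M), q.proj ∈ (chartAt E p.proj).source →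
      T (mkTTM q (S'.val q)) = (trivializationAt (E × E) (TangentSpace 𝓘(ℝ, E).tangent) p
        (mkTTM q (S'.unitField h q))).2 := fun S' q hq => by
    rw [Spray.unitField, trivializationAt_sub_smul_vertical hq]
    rfl
  have hT0 : T ξ₀ = S.unitField h p := by
    rw [hξ₀, hTval S p (mem_chart_source _ _), trivializationAt_mkTTM rfl]
  have hπ : ContinuousAt (fun ξ : TTM E M => ξ.proj) ξ₀ :=
    (FiberBundle.continuous_proj (E × E) (TangentSpace 𝓘(ℝ, E).tangent)).continuousAt
  have hTc : ContinuousAt T ξ₀ := by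
    have c1 : ContinuousAt (fun ξ : TTM E M =>
        (trivializationAt (E × E) (TangentSpace 𝓘(ℝ, E).tangent) p ξ).2) ξ₀ :=
      ((FiberBundle.continuousAt_totalSpace (E × E) (f := fun ξ : TTM E M => ξ)
        (x₀ := ξ₀)).1 continuousAt_id).2
    have c2 : ContinuousAt (fun ξ : TTM E M => 2⁻¹ * dNormSq h ξ.proj ξ.snd) ξ₀ :=
      (continuous_const.mul (continuous_dNormSq h)).continuousAt
    have c3 : ContinuousAt (fun w : TM E M =>
        (trivializationAt E (TangentSpace 𝓘(ℝ, E)) p.proj w).2) p :=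
      ((FiberBundle.continuousAt_totalSpace E (f := fun w : TM E M => w)
        (x₀ := p)).1 continuousAt_id).2
    have c4 : ContinuousAt (fun ξ : TTM E M =>
        (trivializationAt E (TangentSpace 𝓘(ℝ, E)) p.proj ξ.proj).2) ξ₀ :=
      ContinuousAt.comp_of_eq (g := fun w : TM E M =>
        (trivializationAt E (TangentSpace 𝓘(ℝ, E)) p.proj w).2) c3 hπ rfl
    exact c1.sub (c2.smul (continuousAt_const.prodMk c4))
  have hO : ∀ᶠ ξ in 𝓝 ξ₀, ‖T ξ - S.unitField h p‖ < ε ∧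
      ξ.proj.proj ∈ (chartAt E p.proj).source := by
    refine Eventually.and ?_ ?_
    · have := hTc.tendsto.eventually (Metric.ball_mem_nhds _ hε)
      rw [hT0] at this
      exact this.mono fun ξ hξ => mem_ball_iff_norm.1 hξ
    · exact ((FiberBundle.continuous_proj E (TangentSpace 𝓘(ℝ, E))).continuousAt.comp
        hπ).eventually_mem ((chartAt E p.proj).open_source.mem_nhds (mem_chart_source _ _))
  obtain ⟨O, hOs, hOo, hξO⟩ := eventually_nhds_iff.1 hO
  have hpre : (fun v => mkTTM v (S.val v)) ⁻¹' O ∈ 𝓝 p :=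
    S.contMDiff.continuous.continuousAt.preimage_mem_nhds (hOo.mem_nhds hξO)
  obtain ⟨K, hK, hKc, hKO⟩ := exists_mem_nhds_isClosed_subset hpre
  -- Adding everything over the complement of `K` makes this a condition over `K` only.
  have hW := hl (O ∪ (fun ξ : TTM E M => ξ.proj) ⁻¹' Kᶜ)
    (hOo.union (hKc.isOpen_compl.preimage
      (FiberBundle.continuous_proj (E × E) (TangentSpace 𝓘(ℝ, E).tangent))))
    fun v _ => by
      by_cases hv : v ∈ K
      · exact Or.inl (hKO hv)
      · exact Or.inr hv
  refine ⟨K, hK, hW.mono fun k hk q hq => ?_⟩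
  have h1 := (hk q hq.2).resolve_right (fun h => h hq.1)
  obtain ⟨h2, h3⟩ := hOs _ h1
  have h4 := hTval (Sk k) q h3
  rw [h4] at h2
  exact h2

variable [FiniteDimensional ℝ E] [T2Space M] {ι : Type*} {f : Ultrafilter ι}
  {Sk : ι → Spray E M} {A : Set M} {u : ι → ℝ → TM E M} {D : ι → Set ℝ}

/-- A pointwise limit, along an ultrafilter, of unit speed geodesics of sprays which converge to
`S` is a unit speed geodesic of `S`. -/
lemma exists_limit_unitCurve (hA : IsCompact A)
    (hf : SprayTendsto (f : Filter ι) Sk S (unitOver h A)) (hD : ∀ k, (D k).OrdConnected)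
    (hu : ∀ k, (Sk k).IsUnitCurve h (u k) (D k)) (huA : ∀ k, ∀ s ∈ D k, (u k s).proj ∈ A)
    {J : Set ℝ} (hJ : IsOpen J) (hJD : ∀ s ∈ J, ∀ᶠ k in (f : Filter ι), s ∈ D k) :
    ∃ v : ℝ → TM E M, S.IsUnitCurve h v J ∧ ∀ s ∈ J, (v s).proj ∈ A ∧
      Tendsto (fun k => u k s) (f : Filter ι) (𝓝 (v s)) := by
  have hlim : ∀ s ∈ J, ∃ p ∈ unitOver h A, Tendsto (fun k => u k s) (f : Filter ι) (𝓝 p) :=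
    fun s hs => isCompact_iff_ultrafilter_le_nhds.1 (isCompact_unitOver h hA)
      (f.map fun k => u k s) (le_principal_iff.2 ((hJD s hs).mono fun k hk =>
        ⟨huA k s hk, (hu k s hk).1⟩))
  obtain ⟨k₀⟩ : Nonempty ι := (f : Filter ι).nonempty_of_neBot
  have : Nonempty (TM E M) := ⟨u k₀ 0⟩
  choose! v hvA hv using hlim
  refine ⟨v, fun s hs => ⟨(hvA s hs).2, ?_⟩, fun s hs => ⟨(hvA s hs).1, hv s hs⟩⟩
  -- The estimate holds for the approximating curves with an interval of times independent of the
  -- index, and its terms are continuous in the limit, so differentiability needs no uniform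
  -- convergence.
  refine hasVelocityAt_of_eventually_le fun ε hε => ?_
  obtain ⟨C, hCc, hC, -, δ, hδ, hest⟩ := limit_estimate (I := 𝓘(ℝ, E).tangent)
    (l := (f : Filter ι)) (u := u) (V := fun k => (Sk k).unitField h) (D := D)
    (Q := unitOver h A) (fun k t ht => ⟨⟨huA k t ht, (hu k t ht).1⟩, (hu k t ht).2⟩)
    (p := v s) (w := S.unitField h (v s)) (fun ε hε => hf.unitField h (v s) hε)
    (s := fun _ => s) tendsto_const_nhds (hv s hs) hε univ_mem
  have h3 : ∀ᶠ t in 𝓝 s, |t - s| < δ := by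
    filter_upwards [Metric.ball_mem_nhds s hδ] with t ht using by simpa [Real.dist_eq] using ht
  filter_upwards [h3, hJ.mem_nhds hs] with t ht htJ
  have h4 := ((hest t ht).and ((hJD s hs).and (hJD t htJ))).mono fun k hk =>
    hk.1 ((hD k).uIcc_subset hk.2.1 hk.2.2)
  have h5 : v t ∈ C := hCc.mem_of_tendsto (hv t htJ) (h4.mono fun k hk => hk.1)
  refine ⟨hC h5, ?_⟩
  have c1 : Tendsto (fun k => extChartAt 𝓘(ℝ, E).tangent (v s) (u k t)) (f : Filter ι)
      (𝓝 (extChartAt 𝓘(ℝ, E).tangent (v s) (v t))) :=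
    (continuousAt_extChartAt' (hC h5)).tendsto.comp (hv t htJ)
  have c2 : Tendsto (fun k => extChartAt 𝓘(ℝ, E).tangent (v s) (u k s)) (f : Filter ι)
      (𝓝 (extChartAt 𝓘(ℝ, E).tangent (v s) (v s))) :=
    (continuousAt_extChartAt (I := 𝓘(ℝ, E).tangent) (v s)).tendsto.comp (hv s hs)
  exact le_of_tendsto ((c1.sub c2).sub tendsto_const_nhds).norm (h4.mono fun k hk => hk.2)

/-- Geodesics in a compact set that are at time `s k` in `B` are in a neighbourhood of `B` for a
definite time. -/
lemma exists_pos_forall_mem_nhds (hA : IsCompact A)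
    (hf : SprayTendsto (f : Filter ι) Sk S (unitOver h A)) (hD : ∀ k, (D k).OrdConnected)
    (hu : ∀ k, (Sk k).IsUnitCurve h (u k) (D k)) (huA : ∀ k, ∀ s ∈ D k, (u k s).proj ∈ A)
    {B B' : Set M} (hB : IsClosed B) (hBB' : B ⊆ interior B') {s : ι → ℝ} {s₀ : ℝ}
    (hs : Tendsto s (f : Filter ι) (𝓝 s₀)) (hsD : ∀ k, s k ∈ D k)
    (hsB : ∀ k, (u k (s k)).proj ∈ B) :
    ∃ δ > 0, ∀ t, |t - s₀| < δ → ∀ᶠ k in (f : Filter ι), t ∈ D k → (u k t).proj ∈ B' := by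
  obtain ⟨p, hpA, hp⟩ := isCompact_iff_ultrafilter_le_nhds.1 (isCompact_unitOver h hA)
      (f.map fun k => u k (s k)) (le_principal_iff.2 (Eventually.of_forall fun k =>
        ⟨huA k _ (hsD k), (hu k _ (hsD k)).1⟩ :
        ∀ᶠ k in (f : Filter ι), u k (s k) ∈ unitOver h A))
  have hπ := FiberBundle.continuous_proj E (TangentSpace 𝓘(ℝ, E) : M → Type _)
  have hp' : Tendsto (fun k => u k (s k)) (f : Filter ι) (𝓝 p) := hp
  have hpB : p.proj ∈ B := hB.mem_of_tendsto (hπ.continuousAt.tendsto.comp hp')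
    (Eventually.of_forall hsB)
  have hU : TotalSpace.proj ⁻¹' B' ∈ 𝓝 p :=
    hπ.continuousAt.preimage_mem_nhds (mem_interior_iff_mem_nhds.1 (hBB' hpB))
  obtain ⟨C, -, -, hCU, δ, hδ, hest⟩ := limit_estimate (I := 𝓘(ℝ, E).tangent)
    (l := (f : Filter ι)) (u := u) (V := fun k => (Sk k).unitField h) (D := D)
    (Q := unitOver h A) (fun k t ht => ⟨⟨huA k t ht, (hu k t ht).1⟩, (hu k t ht).2⟩)
    (p := p) (w := S.unitField h p) (fun ε hε => hf.unitField h p hε) hs hp' one_pos hU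
  refine ⟨δ, hδ, fun t ht => (hest t ht).mono fun k hk htk => hCU (hk ?_).1⟩
  exact (hD k).uIcc_subset (hsD k) htk

end Limits

/-! ### Stability over a compact set -/

section Core

variable {E : Type*} [NormedAddCommGroup E] [NormedSpace ℝ E]
  {M : Type*} [TopologicalSpace M] [ChartedSpace E M] [IsManifold 𝓘(ℝ, E) ∞ M]
  {S : Spray E M} {h : RMetric E M} {m : ℝ≥0} {A : Set M}

lemma fib_ne_zero_of_normSq {v : TM E M} (hv : normSq h v ≠ 0) : fib v ≠ 0 := fun h0 => by
  have h1 : smulTM 0 v = v := by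
    conv_rhs => rw [← mkTM_fib v]
    rw [smulTM, h0, smul_zero]
  apply hv
  rw [← h1, normSq_smulTM]
  ring

lemma sprayTendsto_const {ι : Type*} (l : Filter ι) (S : Spray E M) (Q : Set (TM E M)) :
    SprayTendsto l (fun _ => S) S Q := fun _ _ h => Eventually.of_forall fun _ => h

/-- The open neighbourhoods of `S(Q)` in `TTM`. -/
abbrev SprayNhd (S : Spray E M) (Q : Set (TM E M)) : Type _ :=
  {W : Set (TTM E M) // IsOpen W ∧ ∀ v ∈ Q, mkTTM v (S.val v) ∈ W}

/-- If no ultrafilter limit of sprays with the property `P` is `S`, then `P` fails for the sprays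
in a neighbourhood of `S`. -/
lemma exists_isOpen_forall_not (S : Spray E M) (Q : Set (TM E M)) (P : Spray E M → Prop)
    (hP : ∀ (f : Ultrafilter (SprayNhd S Q)) (Sk : SprayNhd S Q → Spray E M),
      SprayTendsto (f : Filter (SprayNhd S Q)) Sk S Q → (∀ k, P (Sk k)) → False) :
    ∃ W : Set (TTM E M), IsOpen W ∧ (∀ v ∈ Q, mkTTM v (S.val v) ∈ W) ∧
      ∀ S' : Spray E M, (∀ v ∈ Q, mkTTM v (S'.val v) ∈ W) → ¬ P S' := by
  by_contra! hcon
  have : Nonempty (SprayNhd S Q) := ⟨univ, isOpen_univ, fun _ _ => trivial⟩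
  choose Sk hSk hPk using fun W : SprayNhd S Q => hcon W.1 W.2.1 W.2.2
  let inter : SprayNhd S Q → SprayNhd S Q → SprayNhd S Q := fun W W' =>
    ⟨W.1 ∩ W'.1, W.2.1.inter W'.2.1, fun v hv => ⟨W.2.2 v hv, W'.2.2 v hv⟩⟩
  have : IsCodirectedOrder (SprayNhd S Q) := ⟨fun W W' =>
    ⟨inter W W', show W.1 ∩ W'.1 ⊆ W.1 from inter_subset_left,
      show W.1 ∩ W'.1 ⊆ W'.1 from inter_subset_right⟩⟩
  have : NeBot (atBot : Filter (SprayNhd S Q)) := atBot_neBot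
  refine hP (Ultrafilter.of atBot) Sk (fun W hW hSW => ?_) hPk
  -- The counterexamples are indexed by the neighbourhoods themselves, ordered by inclusion, so no
  -- countable neighbourhood basis is needed.
  refine Ultrafilter.of_le _ ?_
  filter_upwards [eventually_le_atBot (⟨W, hW, hSW⟩ : SprayNhd S Q)] with W' hW' v hv
  exact hW' (hSk W' v hv)

/-- A unit speed geodesic defined on the whole line is, up to parametrization, inextendible. -/
lemma Spray.IsUnitCurve.exists_inextendible (hS : S.IsHomogeneous m) {u : ℝ → TM E M}
    (hu : S.IsUnitCurve h u univ) :
    ∃ (c : ℝ → M) (J : Set ℝ), S.IsInextendible c J ∧ (¬ ∃ p : M, ∀ t ∈ J, c t = p) ∧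
      ∀ t ∈ J, ∃ s, c t = (u s).proj := by
  obtain ⟨τ, θ, w, hτ, hJ, hw, hθ, hτd, hwu⟩ :=
    hu.exists_geodesic hS ⟨isOpen_univ, ordConnected_univ, univ_nonempty⟩
  have hθd : ∀ s, HasDerivAt τ (θ s) s := fun s => hτd s trivial
  have hmem : ∀ s, τ s ∈ τ '' univ := fun s => ⟨s, trivial, rfl⟩
  refine ⟨fun t => (w t).proj, τ '' univ, ⟨hw.isGeodesicOn hJ, ?_⟩, ?_, ?_⟩
  · intro c' J'' hc' hJJ heq
    by_contra hne
    obtain ⟨b, hb, hbJ⟩ : ∃ b ∈ J'', b ∉ τ '' univ := by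
      by_contra! hcon
      exact hne (Subset.antisymm hcon hJJ)
    have hlift : ∀ s, normSq h (lift (E := E) c' (τ s)) = (θ s)⁻¹ ^ 2 := fun s => by
      have h1 : c' =ᶠ[𝓝 (τ s)] fun t => (w t).proj := by
        filter_upwards [hJ.1.mem_nhds (hmem s)] with t ht using heq ht
      have h2 : lift (E := E) c' (τ s) = w (τ s) := by
        rw [← hw.lift_eq (hmem s)]
        have h3 : (mfderiv 𝓘(ℝ, ℝ) 𝓘(ℝ, E) c' (τ s) : ℝ →L[ℝ] E) =
          mfderiv 𝓘(ℝ, ℝ) 𝓘(ℝ, E) (fun t => (w t).proj) (τ s) := h1.mfderiv_eq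
        have h4 := congrArg (fun L : ℝ →L[ℝ] E => L 1) h3
        have h5 : c' (τ s) = (w (τ s)).proj := heq (hmem s)
        exact congrArg₂ mkTM h5 h4
      rw [h2, hwu s trivial, normSq_smulTM, (hu s trivial).1, mul_one]
    have hsub : uIcc (τ 0) b ⊆ J'' := hc'.1.2.1.uIcc_subset (hJJ (hmem 0)) hb
    obtain ⟨R, hR⟩ := (isCompact_uIcc (a := τ 0) (b := b)).exists_bound_of_continuousOn
      (f := fun t => normSq h (lift (E := E) c' t)) fun t ht =>
      ((continuous_normSq h).continuousAt.comp
        (hc'.isIntegralOn t (hsub ht)).continuousAt).continuousWithinAt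
    -- An extension past `b` has bounded speed `1 / θ` between `τ 0` and `b`. So `τ` grows at a
    -- definite rate and would reach `b` within length `(|R| + 1) * |b - τ 0|`, although `b` is not
    -- in its image.
    have hθR : ∀ s, τ s ∈ uIcc (τ 0) b → 1 ≤ θ s * (|R| + 1) := fun s hs => by
      have h1 := hR _ hs
      rw [hlift, Real.norm_of_nonneg (by positivity)] at h1
      have h2 := hθ s trivial
      by_contra! h3
      have h4 : |R| + 1 < (θ s)⁻¹ := by
        rw [lt_inv_comm₀ (by positivity) h2, ← one_div, lt_div_iff₀ (by positivity)]
        exact h3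
      nlinarith [le_abs_self R, abs_nonneg R]
    have hb0 : τ 0 ≠ b := fun h => hbJ (h ▸ hmem 0)
    have hR1 : 0 < |R| + 1 := by positivity
    rcases lt_or_gt_of_ne hb0 with hlt | hlt
    · have hτb : ∀ s, τ s < b := fun s => by
        by_contra hcon
        exact hbJ (hJ.2.1.out (hmem 0) (hmem s) ⟨hlt.le, not_lt.1 hcon⟩)
      have hs : 0 < (|R| + 1) * (b - τ 0) := mul_pos hR1 (sub_pos.2 hlt)
      obtain ⟨r, hr, hr'⟩ := exists_hasDerivAt_eq_slope τ θ hs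
        (fun s _ => (hθd s).continuousAt.continuousWithinAt) fun s _ => hθd s
      have h1 := hθR r (mem_uIcc_of_le (hτ trivial trivial hr.1).le (hτb r).le)
      rw [hr', sub_zero, div_mul_eq_mul_div, le_div_iff₀ hs] at h1
      nlinarith [hτb ((|R| + 1) * (b - τ 0))]
    · have hτb : ∀ s, b < τ s := fun s => by
        by_contra hcon
        exact hbJ (hJ.2.1.out (hmem s) (hmem 0) ⟨not_lt.1 hcon, hlt.le⟩)
      have hs : -((|R| + 1) * (τ 0 - b)) < 0 := neg_neg_of_pos (mul_pos hR1 (sub_pos.2 hlt))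
      obtain ⟨r, hr, hr'⟩ := exists_hasDerivAt_eq_slope τ θ hs
        (fun s _ => (hθd s).continuousAt.continuousWithinAt) fun s _ => hθd s
      have h1 := hθR r (mem_uIcc_of_ge (hτb r).le (hτ trivial trivial hr.2).le)
      rw [hr', div_mul_eq_mul_div, le_div_iff₀ (by linarith)] at h1
      nlinarith [hτb (-((|R| + 1) * (τ 0 - b)))]
  · rintro ⟨p, hp⟩
    have h1 : HasVelocityAt 𝓘(ℝ, E) (fun t => (w t).proj) 0 (τ 0) := by
      refine (hasVelocityAt_const p (τ 0)).congr ?_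
      filter_upwards [hJ.1.mem_nhds (hmem 0)] with t ht using hp t ht
    have h2 := h1.unique (hw _ (hmem 0)).proj
    rw [S.fst_eq] at h2
    refine fib_ne_zero_of_normSq (h := h) (v := w (τ 0)) ?_ h2.symm
    rw [hwu 0 trivial, normSq_smulTM, (hu 0 trivial).1]
    have := hθ 0 trivial
    positivity
  · rintro _ ⟨s, -, rfl⟩
    exact ⟨s, by simp only [hwu s trivial, smulTM_proj]⟩

lemma Spray.IsDisprisoning.not_isUnitCurve_univ (hdis : S.IsDisprisoning)
    (hS : S.IsHomogeneous m) (hA : IsCompact A) {u : ℝ → TM E M}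
    (hu : S.IsUnitCurve h u univ) (huA : ∀ s, (u s).proj ∈ A) : False := by
  obtain ⟨c, J, hc, hnc, hcu⟩ := hu.exists_inextendible hS
  refine hdis c J hc hnc A hA ?_
  rintro _ ⟨t, ht, rfl⟩
  obtain ⟨s, hs⟩ := hcu t ht
  exact hs ▸ huA s

variable [FiniteDimensional ℝ E] [T2Space M]

/-- The translates of a trapped ray by `k` are defined on ever larger half-lines, and their limit is
a trapped unit curve on the whole line. -/
lemma Spray.IsDisprisoning.not_isUnitCurve_Ioi (hdis : S.IsDisprisoning)
    (hS : S.IsHomogeneous m) (hA : IsCompact A) {u : ℝ → TM E M} {a : ℝ}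
    (hu : S.IsUnitCurve h u (Ioi a)) (huA : ∀ s > a, (u s).proj ∈ A) : False := by
  obtain ⟨v, hv, hvA⟩ := exists_limit_unitCurve (f := hyperfilter ℕ) (Sk := fun _ => S)
    (u := fun k s => u (s + k)) (D := fun k => {s | s + k ∈ Ioi a}) (J := univ) hA
    (sprayTendsto_const _ S _)
    (fun k => ⟨fun x hx y _ z hz => show a < z + k by
      have : a < x + k := hx
      linarith [hz.1]⟩)
    (fun k => hu.comp_add k) (fun k s hs => huA _ hs) isOpen_univ fun s _ => by
      have h1 : ∀ᶠ k : ℕ in atTop, s + k ∈ Ioi a :=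
        (tendsto_atTop_add_const_left _ s tendsto_natCast_atTop_atTop).eventually_gt_atTop a
      rw [← Nat.cofinite_eq_atTop] at h1
      exact hyperfilter_le_cofinite h1
  exact hdis.not_isUnitCurve_univ hS hA hv fun s => (hvA s trivial).1

/-- Geodesics, of sprays which converge to `S`, that start outside `B'` and reach `B` inside `A`
meet `B'` after a time which is bounded and bounded away from their ends. -/
lemma exists_return_time (hdis : S.IsDisprisoning) (hS : S.IsHomogeneous m) (hA : IsCompact A)
    {ι : Type*} {f : Ultrafilter ι} {Sk : ι → Spray E M}
    (hf : SprayTendsto (f : Filter ι) Sk S (unitOver h A)) {B B' : Set M} (hB : IsClosed B)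
    (hBB' : B ⊆ interior B') {u : ι → ℝ → TM E M} {β : ι → ℝ} (hβ : ∀ k, 0 ≤ β k)
    (hu : ∀ k, (Sk k).IsUnitCurve h (u k) (Icc 0 (β k)))
    (huA : ∀ k, ∀ s ∈ Icc 0 (β k), (u k s).proj ∈ A) (huB : ∀ k, (u k (β k)).proj ∈ B)
    (hu0 : ∀ k, (u k 0).proj ∉ B') :
    ∃ b b', 0 < b ∧ b < b' ∧ ∀ᶠ k in (f : Filter ι), b' < β k ∧ (u k b).proj ∈ B' := by
  -- Unbounded lengths would give in the limit a ray of `S` trapped in `A`.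
  by_cases hR : ∀ R, ∀ᶠ k in (f : Filter ι), R < β k
  · obtain ⟨v, hv, hvA⟩ := exists_limit_unitCurve hA hf (fun k => ordConnected_Icc) hu huA
      (isOpen_Ioi (a := (0 : ℝ))) fun s hs => (hR s).mono fun k hk => ⟨hs.le, hk.le⟩
    exact (hdis.not_isUnitCurve_Ioi hS hA hv fun s hs => (hvA s hs).1).elim
  · obtain ⟨R, hR⟩ := not_forall.1 hR
    have hR' : ∀ᶠ k in (f : Filter ι), β k ∈ Icc 0 R :=
      (Ultrafilter.eventually_not.2 hR).mono fun k hk => ⟨hβ k, not_lt.1 hk⟩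
    obtain ⟨β₀, -, hβ₀⟩ := isCompact_iff_ultrafilter_le_nhds.1 (isCompact_Icc (a := 0) (b := R))
      (f.map β) (le_principal_iff.2 hR')
    have hβt : Tendsto β (f : Filter ι) (𝓝 β₀) := hβ₀
    obtain ⟨δ, hδ, hδB⟩ := exists_pos_forall_mem_nhds hA hf (fun k => ordConnected_Icc) hu huA hB
      hBB' hβt (fun k => ⟨hβ k, le_rfl⟩) huB
    have hβ0 : 0 ≤ β₀ := ge_of_tendsto' hβt hβ
    have hδβ : δ ≤ β₀ := by
      by_contra! hlt
      obtain ⟨k, hk⟩ := (hδB 0 (by rwa [zero_sub, abs_neg, abs_of_nonneg hβ0])).exists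
      exact hu0 k (hk ⟨le_rfl, hβ k⟩)
    -- The limit curve is available only on an open interval; these times before the end, where the
    -- curves are already in `B'`, keep the return to `B'` inside it.
    refine ⟨β₀ - δ / 2, β₀ - δ / 4, by linarith, by linarith, ?_⟩
    filter_upwards [hβt.eventually_const_lt (show β₀ - δ / 4 < β₀ by linarith),
      hδB (β₀ - δ / 2) (by rw [abs_lt]; constructor <;> linarith)] with k hk hkB
    exact ⟨hk, hkB ⟨by linarith, by linarith⟩⟩

/-- Over a compact set, the sprays close to `S` have no trapped geodesic rays, and their geodesic
segments with ends in `B` have the same bound as those of `S` with ends in the neighbourhood `B'` of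
`B`. -/
lemma exists_isOpen_stable (hdis : S.IsDisprisoning) (hS : S.IsHomogeneous m) (h : RMetric E M)
    (hA : IsCompact A) {B B' B₁ : Set M} (hB : IsClosed B) (hBB' : B ⊆ interior B')
    (hB' : IsClosed B') (hB'₁ : B' ⊆ B₁)
    (hseg : ∀ (c : ℝ → M) (J : Set ℝ), S.IsGeodesicOn c J → ∀ a ∈ J, ∀ b ∈ J, a ≤ b →
      c a ∈ B' → c b ∈ B' → ∀ t ∈ Icc a b, c t ∈ interior B₁) :
    ∃ W : Set (TTM E M), IsOpen W ∧ (∀ v ∈ unitOver h A, mkTTM v (S.val v) ∈ W) ∧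
      ∀ S' : Spray E M, (∀ v ∈ unitOver h A, mkTTM v (S'.val v) ∈ W) →
        (∀ u : ℝ → TM E M, S'.IsUnitCurve h u (Ici 0) → ¬ ∀ s ∈ Ici (0 : ℝ), (u s).proj ∈ A) ∧
        ∀ (m' : ℝ≥0) (u : ℝ → TM E M) (α β : ℝ) (J : Set ℝ), S'.IsHomogeneous m' → 0 ≤ α →
          0 ≤ β → IsOpen J → Icc (-α) β ⊆ J → S'.IsUnitCurve h u J →
          (∀ s ∈ Icc (-α) β, (u s).proj ∈ A) → (u (-α)).proj ∈ B → (u β).proj ∈ B →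
          (u 0).proj ∈ B₁ := by
  obtain ⟨W₁, hW₁o, hW₁S, hW₁⟩ := exists_isOpen_forall_not S (unitOver h A)
    (fun S' => ∃ u : ℝ → TM E M, S'.IsUnitCurve h u (Ici 0) ∧ ∀ s ∈ Ici (0 : ℝ), (u s).proj ∈ A)
    (fun f Sk hf hP => by
      choose u hu huA using hP
      obtain ⟨v, hv, hvA⟩ := exists_limit_unitCurve hA hf (fun k => ordConnected_Ici) hu huA
        (isOpen_Ioi (a := (0 : ℝ))) fun s hs => Eventually.of_forall fun k => mem_Ici.2 hs.le
      exact hdis.not_isUnitCurve_Ioi hS hA hv fun s hs => (hvA s hs).1)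
  obtain ⟨W₂, hW₂o, hW₂S, hW₂⟩ := exists_isOpen_forall_not S (unitOver h A)
    (fun S' => ∃ (m' : ℝ≥0) (u : ℝ → TM E M) (α β : ℝ) (J : Set ℝ), S'.IsHomogeneous m' ∧ 0 ≤ α ∧
      0 ≤ β ∧ IsOpen J ∧ Icc (-α) β ⊆ J ∧ S'.IsUnitCurve h u J ∧
      (∀ s ∈ Icc (-α) β, (u s).proj ∈ A) ∧ (u (-α)).proj ∈ B ∧ (u β).proj ∈ B ∧
      (u 0).proj ∉ B₁)
    (fun f Sk hf hP => by
      choose m' u α β J hm hα hβ hJo hJ hu huA huα huβ hu0 using hP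
      -- The point outside `B₁` is at time `0`; the forward half is treated here and the backward
      -- half below by reversal. As `B' ⊆ B₁`, it is outside `B'` too.
      obtain ⟨b, b', hb, hbb', hbk⟩ := exists_return_time hdis hS hA hf hB hBB' hβ
        (fun k => (hu k).mono ((Icc_subset_Icc_left (by linarith [hα k])).trans (hJ k)))
        (fun k s hs => huA k s ⟨by linarith [hα k, hs.1], hs.2⟩) huβ fun k hk => hu0 k (hB'₁ hk)
      obtain ⟨a, a', ha, haa', hak⟩ := exists_return_time hdis hS hA hf hB hBB' hα
        (u := fun k s => smulTM (-1) (u k (-s)))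
        (fun k => ((hu k).neg (hm k) (hJo k)).mono fun s hs =>
          hJ k ⟨by linarith [hs.2], by linarith [hs.1, hβ k]⟩)
        (fun k s hs => by
          rw [smulTM_proj]
          exact huA k _ ⟨by linarith [hs.2], by linarith [hs.1, hβ k]⟩)
        (fun k => by rw [smulTM_proj]; exact huα k)
        fun k hk => by
          rw [smulTM_proj, neg_zero] at hk
          exact hu0 k (hB'₁ hk)
      obtain ⟨v, hv, hvA⟩ := exists_limit_unitCurve hA hf (fun k => ordConnected_Icc)
        (D := fun k => Icc (-α k) (β k)) (fun k => (hu k).mono (hJ k)) huA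
        (isOpen_Ioo (a := -a') (b := b')) fun s hs => (hak.and hbk).mono fun k hk =>
          ⟨by linarith [hs.1, hk.1.1], by linarith [hs.2, hk.2.1]⟩
      have hπ := FiberBundle.continuous_proj E (TangentSpace 𝓘(ℝ, E) : M → Type _)
      have hvt : ∀ s ∈ Ioo (-a') b', Tendsto (fun k => (u k s).proj) (f : Filter _)
          (𝓝 (v s).proj) := fun s hs => hπ.continuousAt.tendsto.comp (hvA s hs).2
      have m0 : (0 : ℝ) ∈ Ioo (-a') b' := ⟨by linarith, by linarith⟩
      have ma : -a ∈ Ioo (-a') b' := ⟨by linarith, by linarith⟩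
      have mb : b ∈ Ioo (-a') b' := ⟨by linarith, by linarith⟩
      have hva : (v (-a)).proj ∈ B' := hB'.mem_of_tendsto (hvt _ ma) (hak.mono fun k hk => by
        have := hk.2
        rwa [smulTM_proj] at this)
      have hvb : (v b).proj ∈ B' := hB'.mem_of_tendsto (hvt _ mb) (hbk.mono fun k hk => hk.2)
      -- Being outside `B₁` survives the limit only as being outside its interior, which is why
      -- `hseg` is stated with `interior B₁`.
      have hv0 : (v 0).proj ∉ interior B₁ := fun hmem => by
        obtain ⟨k, hk⟩ := ((hvt 0 m0).eventually (isOpen_interior.mem_nhds hmem)).exists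
        exact hu0 k (interior_subset hk)
      obtain ⟨τ, θ, w, hτ, hτJ, hw, -, -, hwv⟩ :=
        hv.exists_geodesic hS ⟨isOpen_Ioo, ordConnected_Ioo, ⟨0, m0⟩⟩
      have hwp : ∀ s ∈ Ioo (-a') b', (w (τ s)).proj = (v s).proj := fun s hs => by
        rw [hwv s hs, smulTM_proj]
      refine hv0 ?_
      rw [← hwp 0 m0]
      exact hseg _ _ (hw.isGeodesicOn hτJ) (τ (-a)) ⟨_, ma, rfl⟩ (τ b) ⟨_, mb, rfl⟩
        (hτ.monotoneOn ma mb (by linarith)) (by rwa [hwp _ ma]) (by rwa [hwp _ mb]) (τ 0)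
        ⟨hτ.monotoneOn ma m0 (by linarith), hτ.monotoneOn m0 mb hb.le⟩)
  refine ⟨W₁ ∩ W₂, hW₁o.inter hW₂o, fun v hv => ⟨hW₁S v hv, hW₂S v hv⟩, fun S' hS' => ⟨?_, ?_⟩⟩
  · exact fun u hu huA => hW₁ S' (fun v hv => (hS' v hv).1) ⟨u, hu, huA⟩
  · intro m' u α β J h1 h2 h3 h4 h5 h6 h7 h8 h9
    by_contra h10
    exact hW₂ S' (fun v hv => (hS' v hv).2) ⟨m', u, α, β, J, h1, h2, h3, h4, h5, h6, h7, h8, h9, h10⟩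

end Core

/-! ### Exhaustions -/

section Exhaustion

variable {X : Type*} [TopologicalSpace X]

/-- Starting from a point, repeatedly pass to the compact sets attached to the members of a locally
finite cover that meet the current set. Only finitely many are added each time, and the union is
clopen. -/
lemma sigmaCompactSpace_of_connected [ParacompactSpace X] [WeaklyLocallyCompactSpace X]
    [ConnectedSpace X] : SigmaCompactSpace X := by
  choose K hK hxK using fun x : X => exists_compact_mem_nhds x
  obtain ⟨v, hvo, hvc, hvf, hvK⟩ := precise_refinement (fun x => interior (K x))
    (fun x => isOpen_interior) (iUnion_eq_univ_iff.2 fun x => ⟨x, mem_interior_iff_mem_nhds.2 (hxK x)⟩)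
  let next : Set X → Set X := fun C => ⋃ i ∈ {i | (v i ∩ C).Nonempty}, K i
  obtain ⟨x₀⟩ : Nonempty X := inferInstance
  let C : ℕ → Set X := fun n => next^[n] {x₀}
  have hCs : ∀ n, C (n + 1) = next (C n) := fun n => Function.iterate_succ_apply' next n {x₀}
  have hC : ∀ n, IsCompact (C n) := fun n => by
    induction n with
    | zero => exact isCompact_singleton
    | succ n ih =>
      rw [hCs]
      exact (hvf.finite_nonempty_inter_compact ih).isCompact_biUnion fun i _ => hK i
  have hmeet : ∀ n i, (v i ∩ C n).Nonempty → v i ⊆ C (n + 1) := fun n i hi => by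
    rw [hCs]
    exact ((hvK i).trans interior_subset).trans (subset_biUnion_of_mem (u := K) hi)
  have hU : IsClopen (⋃ n, C n) := by
    constructor
    · refine isClosed_of_closure_subset fun x hx => ?_
      obtain ⟨i, hi⟩ := iUnion_eq_univ_iff.1 hvc x
      obtain ⟨y, hyi, hy⟩ := mem_closure_iff.1 hx (v i) (hvo i) hi
      obtain ⟨n, hn⟩ := mem_iUnion.1 hy
      exact mem_iUnion.2 ⟨n + 1, hmeet n i ⟨y, hyi, hn⟩ hi⟩
    · refine isOpen_iff_mem_nhds.2 fun x hx => ?_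
      obtain ⟨n, hn⟩ := mem_iUnion.1 hx
      obtain ⟨i, hi⟩ := iUnion_eq_univ_iff.1 hvc x
      exact mem_of_superset ((hvo i).mem_nhds hi)
        ((hmeet n i ⟨x, hi, hn⟩).trans (subset_iUnion C (n + 1)))
  exact ⟨C, hC, hU.eq_univ ⟨x₀, mem_iUnion.2 ⟨0, rfl⟩⟩⟩

/-- An exhaustion by compact sets in which each set absorbs a hull of a neighbourhood of the
previous one. -/
lemma exists_exhaustion [WeaklyLocallyCompactSpace X] [SigmaCompactSpace X]
    {P : Set X → Set X → Prop} (hP : ∀ K, IsCompact K → ∃ K', IsCompact K' ∧ P K K') :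
    ∃ B B' K' : ℕ → Set X, (∀ n, IsCompact (B n)) ∧ (∀ n, IsCompact (B' n)) ∧ B 0 = ∅ ∧
      (∀ n, B n ⊆ interior (B' n)) ∧ (∀ n, B' n ⊆ B (n + 1)) ∧ (∀ n, P (B' n) (K' n)) ∧
      (∀ n, K' n ⊆ interior (B (n + 1))) ∧ ∀ x, ∃ n, x ∈ interior (B n) := by
  have step : ∀ (n : ℕ) (B : {B : Set X // IsCompact B}), ∃ B' K' B₁ : Set X, IsCompact B' ∧
      B.1 ⊆ interior B' ∧ P B' K' ∧ IsCompact B₁ ∧ B' ∪ (K' ∪ compactCovering X n) ⊆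
        interior B₁ := by
    rintro n ⟨B, hB⟩
    obtain ⟨B', hB', hBB'⟩ := exists_compact_superset hB
    obtain ⟨K', hK', hPK'⟩ := hP B' hB'
    obtain ⟨B₁, hB₁, hB₁'⟩ :=
      exists_compact_superset (hB'.union (hK'.union (isCompact_compactCovering X n)))
    exact ⟨B', K', B₁, hB', hBB', hPK', hB₁, hB₁'⟩
  choose B' K' B₁ hB' hBB' hPK' hB₁ hB₁' using step
  let C : ℕ → {B : Set X // IsCompact B} := fun n =>
    Nat.rec ⟨∅, isCompact_empty⟩ (fun n B => ⟨B₁ n B, hB₁ n B⟩) n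
  have hC : ∀ n, B' n (C n) ∪ (K' n (C n) ∪ compactCovering X n) ⊆ interior (C (n + 1)).1 :=
    fun n => hB₁' n (C n)
  refine ⟨fun n => (C n).1, fun n => B' n (C n), fun n => K' n (C n), fun n => (C n).2,
    fun n => hB' n _, rfl, fun n => hBB' n _,
    fun n => (subset_union_left.trans (hC n)).trans interior_subset, fun n => hPK' n _,
    fun n => (subset_union_left.trans subset_union_right).trans (hC n), fun x => ?_⟩
  obtain ⟨n, hn⟩ := exists_mem_compactCovering x
  exact ⟨n + 1, hC n (Or.inr (Or.inr hn))⟩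

lemma exists_subset_of_isCompact {B : ℕ → Set X} (hB : Monotone B)
    (hx : ∀ x, ∃ n, x ∈ interior (B n)) {K : Set X} (hK : IsCompact K) : ∃ n, K ⊆ B n := by
  obtain ⟨n, hn⟩ := hK.elim_directed_cover (fun n => interior (B n)) (fun _ => isOpen_interior)
    (fun x _ => mem_iUnion.2 (hx x)) (Monotone.directed_le fun i j hij => interior_mono (hB hij))
  exact ⟨n, hn.trans interior_subset⟩

/-- The interior of `B m` meets only the shells with `n < m`. -/
lemma locallyFinite_diff_interior {B : ℕ → Set X} (hB : Monotone B)
    (hx : ∀ x, ∃ n, x ∈ interior (B n)) : LocallyFinite fun n => B (n + 2) \ interior (B n) := by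
  intro x
  obtain ⟨m, hm⟩ := hx x
  refine ⟨interior (B m), isOpen_interior.mem_nhds hm, (finite_lt_nat m).subset ?_⟩
  rintro n ⟨y, hy, hym⟩
  by_contra hnm
  exact hy.2 (interior_mono (hB (not_lt.1 hnm)) hym)

/-- The last time in `B` works: if the curve were in the interior then, it would still be in `B`
shortly after. Together with `exists_first_mem` this cuts out an excursion lying in a shell. -/
lemma exists_last_mem {c : ℝ → X} {a t : ℝ} (hat : a ≤ t) (hc : ContinuousOn c (Icc a t))
    {B : Set X} (hB : IsClosed B) (ha : c a ∈ B) (ht : c t ∉ B) :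
    ∃ a' ∈ Icc a t, c a' ∈ B ∧ ∀ s ∈ Icc a' t, c s ∉ interior B := by
  obtain ⟨a', ⟨ha'I, ha'B⟩, ha'⟩ := (isCompact_Icc.of_isClosed_subset
    (hc.preimage_isClosed_of_isClosed isClosed_Icc hB) inter_subset_left).exists_isGreatest
    ⟨a, ⟨le_rfl, hat⟩, ha⟩
  have hlt : a' < t := lt_of_le_of_ne ha'I.2 fun h => ht (h ▸ ha'B)
  have hgt : ∀ s ∈ Ioc a' t, c s ∉ B := fun s hs hsB =>
    hs.1.not_ge (ha' ⟨⟨ha'I.1.trans hs.1.le, hs.2⟩, hsB⟩)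
  refine ⟨a', ha'I, ha'B, fun s hs hsB => ?_⟩
  rcases hs.1.eq_or_lt with rfl | h1
  · have h2 : ∀ᶠ r in 𝓝[>] a', c r ∈ interior B := by
      refine (((hc a' ha'I).mono (Ioc_subset_Icc_self.trans
        (Icc_subset_Icc_left ha'I.1))).eventually_mem (isOpen_interior.mem_nhds hsB)).filter_mono ?_
      exact nhdsWithin_le_of_mem (Ioc_mem_nhdsGT hlt)
    obtain ⟨r, hr, hr'⟩ := (h2.and (Ioc_mem_nhdsGT hlt)).exists
    exact hgt r hr' (interior_subset hr)
  · exact hgt s ⟨h1, hs.2⟩ (interior_subset hsB)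

lemma exists_first_mem {c : ℝ → X} {b t : ℝ} (htb : t ≤ b) (hc : ContinuousOn c (Icc t b))
    {B : Set X} (hB : IsClosed B) (hb : c b ∈ B) (ht : c t ∉ B) :
    ∃ b' ∈ Icc t b, c b' ∈ B ∧ ∀ s ∈ Icc t b', c s ∉ interior B := by
  obtain ⟨a', ha', h1, h2⟩ := exists_last_mem (c := fun s => c (-s)) (neg_le_neg htb)
    (hc.comp continuousOn_neg fun s hs => ⟨by linarith [hs.2], by linarith [hs.1]⟩) hB
    (by rwa [neg_neg]) (by rwa [neg_neg])
  refine ⟨-a', ⟨by linarith [ha'.2], by linarith [ha'.1]⟩, h1, fun s hs => ?_⟩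
  have := h2 (-s) ⟨by linarith [hs.2], by linarith [hs.1]⟩
  rwa [neg_neg] at this

end Exhaustion

/-! ### Sprays that are stable over each shell of an exhaustion -/

section Global

variable {E : Type*} [NormedAddCommGroup E] [NormedSpace ℝ E]
  {M : Type*} [TopologicalSpace M] [ChartedSpace E M] [IsManifold 𝓘(ℝ, E) ∞ M]

/-- The conclusion of `exists_isOpen_stable`: no geodesic ray is trapped in `A`, and the geodesic
segments in `A` with ends in `B` lie in `B₁`. -/
structure Spray.IsStableOver (S : Spray E M) (h : RMetric E M) (A B B₁ : Set M) : Prop where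
  ray : ∀ u : ℝ → TM E M, S.IsUnitCurve h u (Ici 0) → ¬ ∀ s ∈ Ici (0 : ℝ), (u s).proj ∈ A
  segment : ∀ (u : ℝ → TM E M) (α β : ℝ) (J : Set ℝ), 0 ≤ α → 0 ≤ β → IsOpen J →
    Icc (-α) β ⊆ J → S.IsUnitCurve h u J → (∀ s ∈ Icc (-α) β, (u s).proj ∈ A) →
    (u (-α)).proj ∈ B → (u β).proj ∈ B → (u 0).proj ∈ B₁

variable {S : Spray E M} {h : RMetric E M} {m : ℝ≥0} {A B B₁ : Set M} {c : ℝ → M} {J : Set ℝ}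

/-- The complement is a locally finite union of closed sets. -/
lemma isOpen_forall_mem {A : ℕ → Set M} (hA : ∀ n, IsClosed (A n)) (hAf : LocallyFinite A)
    {W : ℕ → Set (TTM E M)} (hW : ∀ n, IsOpen (W n)) :
    IsOpen {ξ : TTM E M | ∀ n, ξ.proj.proj ∈ A n → ξ ∈ W n} := by
  have hπ : Continuous fun ξ : TTM E M => ξ.proj.proj :=
    (FiberBundle.continuous_proj E (TangentSpace 𝓘(ℝ, E))).comp
      (FiberBundle.continuous_proj (E × E) (TangentSpace 𝓘(ℝ, E).tangent))
  have h1 : IsClosed (⋃ n, (fun ξ : TTM E M => ξ.proj.proj) ⁻¹' A n ∩ (W n)ᶜ) :=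
    ((hAf.preimage_continuous hπ).subset fun n => inter_subset_left).isClosed_iUnion fun n =>
      ((hA n).preimage hπ).inter (hW n).isClosed_compl
  convert h1.isOpen_compl using 1
  ext ξ
  simp

/-- The same `W` cuts out a basic open set in every degree, as the weak topology requires. -/
lemma isOpen_setOf_forall_mem_unitBundle (h : RMetric E M) {W : Set (TTM E M)} (hW : IsOpen W) :
    IsOpen[weakTopology h]
      {S : SprH E M | ∀ v ∈ unitBundle h, mkTTM v (S.1.val v) ∈ W} := by
  rw [isOpen_iSup_iff]
  intro m
  rw [isOpen_coinduced]
  exact TopologicalSpace.isOpen_generateFrom_of_mem ⟨W, hW, rfl⟩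

lemma Spray.IsGeodesicOn.continuousOn (hc : S.IsGeodesicOn c J) : ContinuousOn c J := fun t ht =>
  ((FiberBundle.continuous_proj E (TangentSpace 𝓘(ℝ, E) : M → Type _)).continuousAt.comp
    (hc.isIntegralOn t ht).continuousAt).continuousWithinAt

variable [FiniteDimensional ℝ E] [T2Space M]

lemma Spray.IsStableOver.geodesic_segment (hst : S.IsStableOver h A B B₁) (hS : S.IsHomogeneous m)
    (hB : B ⊆ B₁) (hc : S.IsGeodesicOn c J) {a b t : ℝ} (ha : a ∈ J) (hb : b ∈ J)
    (ht : t ∈ Icc a b) (hA : ∀ s ∈ Icc a b, c s ∈ A) (haB : c a ∈ B) (hbB : c b ∈ B) :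
    c t ∈ B₁ := by
  have hI : Icc a b ⊆ J := hc.1.2.1.out ha hb
  -- If the points differ, the geodesic is nonconstant, so it has an arc length parametrization,
  -- centred at `t`.
  by_cases hat : c a = c t
  · exact hB (hat ▸ haB)
  obtain ⟨l, ρ, u, hl0, hl, hlJ, hu, -, hlift, hld, -⟩ :=
    hc.exists_unitCurve hS h (hc.fib_ne_zero hS ha (hI ht) hat) (hI ht)
  have hp : ∀ s ∈ J, (u (l s)).proj = c s := fun s hs => by
    have := congrArg TotalSpace.proj (hlift s hs)
    rw [smulTM_proj] at this
    exact this.symm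
  have hmem : Icc (-(-l a)) (l b) ⊆ l '' Icc a b := by
    rw [neg_neg]
    exact intermediate_value_Icc (ht.1.trans ht.2) fun s hs =>
      (hld s (hI hs)).continuousAt.continuousWithinAt
  have h1 := hst.segment u (-l a) (l b) (l '' J)
    (by have := hl.monotoneOn ha (hI ht) ht.1; linarith)
    (by have := hl.monotoneOn (hI ht) hb ht.2; linarith) hlJ.1
    (hmem.trans (image_mono hI)) hu (fun s hs => by
      obtain ⟨r, hr, rfl⟩ := hmem hs
      rw [hp r (hI hr)]
      exact hA r hr) (by rwa [neg_neg, hp a ha]) (by rwa [hp b hb])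
  rwa [← hl0, hp t (hI ht)] at h1

/-- The trapped part has infinite length, so in arc length it covers all of `Ici 0`. -/
lemma Spray.IsStableOver.not_ray (hst : S.IsStableOver h A B B₁) (hS : S.IsHomogeneous m)
    (hA : IsCompact A) (hc : S.IsInextendible c J) (hnc : ¬ ∃ p : M, ∀ t ∈ J, c t = p) {t₀ : ℝ}
    (ht₀ : t₀ ∈ J) (hcA : ∀ t ∈ J, t₀ ≤ t → c t ∈ A) : False := by
  obtain ⟨t, ht, htc⟩ : ∃ t ∈ J, c t ≠ c t₀ := by
    by_contra! hcon
    exact hnc ⟨_, hcon⟩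
  obtain ⟨l, ρ, u, hl0, hl, hlJ, hu, hρ, hlift, hld, hr⟩ :=
    hc.1.exists_unitCurve hS h (hc.1.fib_ne_zero hS ht ht₀ htc) ht₀
  have hmem : Ici (0 : ℝ) ⊆ l '' (J ∩ Ici t₀) := fun L hL => by
    obtain ⟨r, hr, htr, hLr⟩ :=
      exists_lt_length_of_inextendible hc ht₀ hl0 hu hρ hlift hld hr hA hcA L
    have hI : Icc t₀ r ⊆ J := hc.1.1.2.1.out ht₀ hr
    obtain ⟨s, hs, rfl⟩ := intermediate_value_Icc htr (fun s hs =>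
      (hld s (hI hs)).continuousAt.continuousWithinAt)
      (show L ∈ Icc (l t₀) (l r) from ⟨hl0 ▸ hL, hLr.le⟩)
    exact ⟨s, ⟨hI hs, hs.1⟩, rfl⟩
  refine hst.ray u (hu.mono (hmem.trans (image_mono inter_subset_left))) fun s hs => ?_
  obtain ⟨r, hr, rfl⟩ := hmem hs
  have := congrArg TotalSpace.proj (hlift r hr.1)
  rw [smulTM_proj] at this
  rw [← this]
  exact hcA r hr.1 hr.2

variable {B : ℕ → Set M}

/-- A compact segment lies in some `B N`. A part of it in the outermost shell is an excursion with
ends in the inner set, so stability over that shell lowers the index by one, down to `n + 1`. -/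
lemma mem_succ_of_stable (hB : Monotone B) (hBc : ∀ n, IsClosed (B n))
    (hx : ∀ x, ∃ n, x ∈ interior (B n)) (hS : S.IsHomogeneous m)
    (hst : ∀ n, S.IsStableOver h (B (n + 2) \ interior (B n)) (B n) (B (n + 1)))
    (hc : S.IsGeodesicOn c J) {a b : ℝ} (ha : a ∈ J) (hb : b ∈ J) {n : ℕ} (haB : c a ∈ B n)
    (hbB : c b ∈ B n) : ∀ t ∈ Icc a b, c t ∈ B (n + 1) := by
  have hI : Icc a b ⊆ J := hc.1.2.1.out ha hb
  have hcI := hc.continuousOn.mono hI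
  have key : ∀ k, (∀ t ∈ Icc a b, c t ∈ B (n + 1 + k)) → ∀ t ∈ Icc a b, c t ∈ B (n + 1) := by
    intro k
    induction k with
    | zero => exact id
    | succ k ih =>
      refine fun hk => ih fun t ht => ?_
      by_contra hcon
      have ht' : c t ∉ B (n + k) := fun h => hcon (hB (by omega) h)
      -- The maximal excursion around `t` that avoids the interior of `B (n + k)`; with `hk` it lies
      -- in the shell of index `n + k`.
      obtain ⟨a', ha'I, ha'B, ha'⟩ := exists_last_mem ht.1
        (hcI.mono (Icc_subset_Icc_right ht.2)) (hBc (n + k)) (hB (by omega) haB) ht'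
      obtain ⟨b', hb'I, hb'B, hb'⟩ := exists_first_mem ht.2
        (hcI.mono (Icc_subset_Icc_left ht.1)) (hBc (n + k)) (hB (by omega) hbB) ht'
      have h1 : a' ∈ Icc a b := ⟨ha'I.1, ha'I.2.trans ht.2⟩
      have h2 : b' ∈ Icc a b := ⟨ht.1.trans hb'I.1, hb'I.2⟩
      refine hcon (hB (show n + k + 1 ≤ n + 1 + k by omega) ?_)
      refine (hst (n + k)).geodesic_segment hS (hB (by omega)) hc (hI h1) (hI h2)
        ⟨ha'I.2, hb'I.1⟩ (fun s hs => ⟨?_, ?_⟩) ha'B hb'B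
      · exact hB (by omega) (hk s ⟨h1.1.trans hs.1, hs.2.trans h2.2⟩)
      · rcases le_total s t with hst | hst
        · exact ha' s ⟨hs.1, hst⟩
        · exact hb' s ⟨hst, hs.2⟩
  obtain ⟨N, hN⟩ := exists_subset_of_isCompact hB hx (isCompact_Icc.image_of_continuousOn hcI)
  exact key N fun t ht => hB (by omega) (hN ⟨t, ht, rfl⟩)

lemma isPseudoconvex_of_stable (hB : Monotone B) (hBc : ∀ n, IsCompact (B n))
    (hx : ∀ x, ∃ n, x ∈ interior (B n)) (hS : S.IsHomogeneous m)
    (hst : ∀ n, S.IsStableOver h (B (n + 2) \ interior (B n)) (B n) (B (n + 1))) :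
    S.IsPseudoconvex := by
  intro K hK
  obtain ⟨n, hn⟩ := exists_subset_of_isCompact hB hx hK
  exact ⟨B (n + 1), hBc _, fun c J hc a ha b hb _ hca hcb =>
    mem_succ_of_stable hB (fun n => (hBc n).isClosed) hx hS hst hc ha hb (hn hca) (hn hcb)⟩

/-- Take the smallest `N` with the geodesic in `B (N + 2)` and a point `t₁` outside `B (N + 1)`. If
one of the two rays from `t₁` avoids `B N`, it is trapped in a shell; otherwise the segment between
two points in `B N` is confined to `B (N + 1)`, yet passes through `t₁`. -/
lemma isDisprisoning_of_stable (hB : Monotone B) (hBc : ∀ n, IsCompact (B n)) (hB0 : B 0 = ∅)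
    (hx : ∀ x, ∃ n, x ∈ interior (B n)) (hS : S.IsHomogeneous m)
    (hst : ∀ n, S.IsStableOver h (B (n + 2) \ interior (B n)) (B n) (B (n + 1))) :
    S.IsDisprisoning := by
  intro c J hc hnc K hK hcK
  have hAc : ∀ n, IsCompact (B (n + 2) \ interior (B n)) := fun n =>
    (hBc _).diff isOpen_interior
  have hex : ∃ N, ∀ t ∈ J, c t ∈ B (N + 2) := by
    obtain ⟨N, hN⟩ := exists_subset_of_isCompact hB hx hK
    exact ⟨N, fun t ht => hB (by omega) (hN (hcK ⟨t, ht, rfl⟩))⟩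
  classical
  obtain ⟨N, hN, hmin⟩ : ∃ N, (∀ t ∈ J, c t ∈ B (N + 2)) ∧
      ∀ k < N, ¬ ∀ t ∈ J, c t ∈ B (k + 2) :=
    ⟨Nat.find hex, Nat.find_spec hex, fun k hk => Nat.find_min hex hk⟩
  -- Stated as an implication to include `N = 0`, where minimality gives nothing, but `B 0` is
  -- empty.
  obtain ⟨t₁, ht₁, hct₁⟩ : ∃ t₁ ∈ J, c t₁ ∈ B (N + 1) → ∀ t ∈ J, c t ∉ B N := by
    rcases N with _ | k
    · obtain ⟨t, ht⟩ := hc.1.1.2.2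
      exact ⟨t, ht, fun _ s _ => by simp [hB0]⟩
    · obtain ⟨t, ht, hct⟩ : ∃ t ∈ J, c t ∉ B (k + 2) := by
        by_contra! hcon
        exact hmin k k.lt_succ_self hcon
      exact ⟨t, ht, fun h => absurd h hct⟩
  by_cases hfw : ∀ b ∈ J, t₁ ≤ b → c b ∉ B N
  · exact (hst N).not_ray hS (hAc N) hc hnc ht₁ fun t ht htt =>
      ⟨hN t ht, fun h => hfw t ht htt (interior_subset h)⟩
  by_cases hbw : ∀ a ∈ J, a ≤ t₁ → c a ∉ B N
  · refine (hst N).not_ray hS (hAc N) (hc.neg hS) ?_ (t₀ := -t₁) (by simpa using ht₁)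
      fun t ht htt => ⟨hN _ ht, fun h => hbw _ ht (by linarith) (interior_subset h)⟩
    rintro ⟨p, hp⟩
    exact hnc ⟨p, fun t ht => by simpa using hp (-t) (by simpa using ht)⟩
  push Not at hfw hbw
  obtain ⟨b, hb, htb, hcb⟩ := hfw
  obtain ⟨a, ha, hat, hca⟩ := hbw
  exact hct₁ (mem_succ_of_stable hB (fun n => (hBc n).isClosed) hx hS hst hc.1 ha hb hca hcb t₁
    ⟨hat, htb⟩) a ha hca

end Global

end SprayStability

end

theorem mainTheorem5
    {E : Type*} [NormedAddCommGroup E] [NormedSpace ℝ E] [FiniteDimensional ℝ E]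
    {M : Type*} [TopologicalSpace M] [ChartedSpace E M] [IsManifold 𝓘(ℝ, E) ∞ M]
    [T2Space M] [ParacompactSpace M] [ConnectedSpace M]
    (h : SprayStability.RMetric E M) (hc : SprayStability.IsCompleteMetric h)
    (S : SprayStability.SprH E M)
    (hpc : S.1.IsPseudoconvex) (hdis : S.1.IsDisprisoning) :
    ∃ W : Set (SprayStability.SprH E M),
      IsOpen[SprayStability.weakTopology h] W ∧ S ∈ W ∧
        ∀ S' ∈ W, S'.1.IsPseudoconvex ∧ S'.1.IsDisprisoning := by
  open SprayStability in
  have : LocallyCompactSpace M := Manifold.locallyCompact_of_finiteDimensional 𝓘(ℝ, E)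
  have : SigmaCompactSpace M := sigmaCompactSpace_of_connected
  obtain ⟨m, hS⟩ := S.2
  -- Pseudoconvexity of `S` is exactly the hull condition from which the exhaustion is built.
  obtain ⟨B, B', K', hB, hB', hB0, hBB', hB'B, hK', hK'B, hx⟩ := exists_exhaustion hpc
  have hmono : Monotone B := monotone_nat_of_le_succ fun n =>
    ((hBB' n).trans interior_subset).trans (hB'B n)
  choose W hWo hWS hW using fun n => exists_isOpen_stable hdis hS h
    (A := B (n + 2) \ interior (B n)) ((hB _).diff isOpen_interior) (hB n).isClosed (hBB' n)
    (hB' n).isClosed (hB'B n) fun c J hc a ha b hb hab hca hcb t ht =>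
      hK'B n (hK' n c J hc a ha b hb hab hca hcb t ht)
  have hAf := locallyFinite_diff_interior hmono hx
  refine ⟨_, isOpen_setOf_forall_mem_unitBundle h (isOpen_forall_mem
    (fun n => ((hB _).diff isOpen_interior).isClosed) hAf hWo),
    fun v hv n hn => hWS n v ⟨hn, hv⟩, fun S' hS' => ?_⟩
  obtain ⟨m', hm'⟩ := S'.2
  have hst : ∀ n, S'.1.IsStableOver h (B (n + 2) \ interior (B n)) (B n) (B (n + 1)) := fun n => by
    obtain ⟨h1, h2⟩ := hW n S'.1 fun v hv => hS' v hv.2 n hv.1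
    exact ⟨h1, fun u α β J => h2 m' u α β J hm'⟩
  exact ⟨isPseudoconvex_of_stable hmono hB hx hm' hst,
    isDisprisoning_of_stable hmono hB hB0 hx hm' hst⟩
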